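/- Let $\Omega\subset\mathbb{C}^p\equiv\mathbb{R}^{2p}$ be open. All nets are indexed by $\varepsilon\in(0,1)$ and all $O$-estimates refer to $\varepsilon\to 0$. Let $\mathcal{G}(\Omega)=\mathcal{E}_M(\Omega)/\mathcal{N}(\Omega)$ be the simplified Colombeau algebra: $\mathcal{E}_M(\Omega)$ consists of the nets $(f_\varepsilon)_\varepsilon$ of complex-valued $C^\infty$ functions on $\Omega$ such that for every compact $K\subset\Omega$ and every (real) multi-index $\alpha$ there is $a\in\mathbb{R}$ with $\sup_K|\partial^\alpha f_\varepsilon|=O(\varepsilon^a)$, and $\mathcal{N}(\Omega)$ of those for which this holds for every $a\in\mathbb{R}$. Let $\tilde{\mathbb{C}}$ be the ring of generalized complex numbers (nets in $\mathbb{C}$ that are $O(\varepsilon^a)$ for some $a\in\mathbb{R}$, modulo nets that are $O(\varepsilon^a)$ for all $a$), and let $\tilde\Omega$ be the set of generalized points of $\Omega$ (nets in $\Omega$ that are $O(\varepsilon^{-a})$ for some $a>0$, modulo $|x_\varepsilon-y_\varepsilon|=O(\varepsilon^a)$ for all $a>0$). Both carry the sharp topology, given by the ultrametric $d(x,y)=\exp\left(-\sup\{a:\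 |x_\varepsilon-y_\varepsilon|=O(\varepsilon^a)\}\right)$. Let $\tilde\Omega_c\subset\tilde\Omega$ be the set of compactly supported generalized points, i.e. those having a representative with $x_\varepsilon\in K$ for all small $\varepsilon$, for some compact $K\subset\Omega$. For $f=[(f_\varepsilon)_\varepsilon]\in\mathcal{G}(\Omega)$ and $\tilde s=[(s_\varepsilon)_\varepsilon]\in\tilde\Omega_c$, with $(s_\varepsilon)_\varepsilon$ compactly supported, put $f(\tilde s)=[(f_\varepsilon(s_\varepsilon))_\varepsilon]\in\tilde{\mathbb{C}}$. The generalized function $f$ is called holomorphic if $\bar\partial_{z_i}f=0$ in $\mathcal{G}(\Omega)$ for $i=1,\dots,p$, i.e. if for every representative $(f_\varepsilon)_\varepsilon$ of $f$ the nets $\left(\tfrac12(\partial_{x_i}+\mathrm{i}\,\partial_{y_i})f_\varepsilon\right)_\varepsilon$ belong to $\mathcal{N}(\Omega)$. It is called S-holomorphic if for every $\tilde s_0\in\tilde\Omega_c$ there are $a_n\in\tilde{\mathbb{C}}$ ($n\in\mathbb{N}_0^p$) and a sharp neighborhood $\tilde W\subset\tilde\Omega_c$ of $\tilde s_0$ in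 $\tilde\Omega$ such that for every $\tilde s\in\tilde W$ the series $\sum_{n\in\mathbb{N}_0^p}a_n(\tilde s-\tilde s_0)^n$, where $(\tilde s-\tilde s_0)^n=\prod_{i=1}^p(\tilde s_i-\tilde s_{0,i})^{n_i}$, converges to $f(\tilde s)$ in the sharp topology of $\tilde{\mathbb{C}}$. **Theorem.** For every open $\Omega\subset\mathbb{C}^p$ and every $f\in\mathcal{G}(\Omega)$, $f$ is holomorphic if and only if $f$ is S-holomorphic. -/

import Mathlib

open Filter Topology Asymptotics
open scoped ContDiff

noncomputable section

namespace Colombeau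

/-! ### Nets and their orders of growth -/

/-- The index set `(0,1)` of all nets. -/
abbrev Idx : Type := Set.Ioo (0 : ℝ) 1

/-- The filter "`ε → 0`" on the index set `(0,1)`. -/
def toZero : Filter Idx := comap (fun ε : Idx => (ε : ℝ)) (𝓝 0)

/-- `|u_ε| = O(ε^a)` as `ε → 0`. -/
def NetO {E : Type*} [NormedAddCommGroup E] (u : Idx → E) (a : ℝ) : Prop :=
  u =O[toZero] fun ε : Idx => (ε : ℝ) ^ a

/-- `exp (-v(u))`, where `v(u) = sup {a : |u_ε| = O(ε^a)}`, written as `inf {exp (-a) : …}` so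
that it is `0` when `v(u) = ∞`. -/
def netNorm {E : Type*} [NormedAddCommGroup E] (u : Idx → E) : ℝ :=
  sInf ((fun a : ℝ => Real.exp (-a)) '' {a : ℝ | NetO u a})

theorem rpow_anti (ε : Idx) {a b : ℝ} (h : a ≤ b) : (ε : ℝ) ^ b ≤ (ε : ℝ) ^ a :=
  Real.rpow_le_rpow_of_exponent_ge ε.2.1 ε.2.2.le h

section

variable {E : Type*} [NormedAddCommGroup E] {u v w : Idx → E} {a b : ℝ}

theorem NetO.mono (h : NetO u b) (hab : a ≤ b) : NetO u a := by
  refine IsBigO.trans h (IsBigO.of_bound 1 (Eventually.of_forall fun ε => ?_))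
  rw [Real.norm_of_nonneg (Real.rpow_nonneg ε.2.1.le _),
    Real.norm_of_nonneg (Real.rpow_nonneg ε.2.1.le _), one_mul]
  exact rpow_anti ε hab

theorem NetO.add (hu : NetO u a) (hv : NetO v a) : NetO (u + v) a := IsBigO.add hu hv

theorem NetO.neg (hu : NetO u a) : NetO (-u) a := IsBigO.neg_left hu

theorem NetO.sub (hu : NetO u a) (hv : NetO v a) : NetO (u - v) a := IsBigO.sub hu hv

theorem NetO.zero (a : ℝ) : NetO (0 : Idx → E) a := isBigO_zero _ _

theorem NetO.mul {u v : Idx → ℂ} (hu : NetO u a) (hv : NetO v b) : NetO (u * v) (a + b) := by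
  refine (IsBigO.mul hu hv).congr_right fun ε => ?_
  rw [Real.rpow_add ε.2.1]

theorem bddBelow_netNorm (u : Idx → E) :
    BddBelow ((fun a : ℝ => Real.exp (-a)) '' {a : ℝ | NetO u a}) :=
  ⟨0, by rintro _ ⟨a, -, rfl⟩; exact (Real.exp_pos _).le⟩

theorem netNorm_nonneg (u : Idx → E) : 0 ≤ netNorm u :=
  Real.sInf_nonneg (by rintro _ ⟨a, -, rfl⟩; exact (Real.exp_pos _).le)

theorem netNorm_lt (hu : ∃ a, NetO u a) {r : ℝ} (h : netNorm u < r) :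
    ∃ a, NetO u a ∧ Real.exp (-a) < r := by
  obtain ⟨_, ⟨a, ha, rfl⟩, hr⟩ := exists_lt_of_csInf_lt (by
    obtain ⟨a, ha⟩ := hu; exact ⟨_, a, ha, rfl⟩) h
  exact ⟨a, ha, hr⟩

theorem netNorm_le (h : NetO u a) : netNorm u ≤ Real.exp (-a) :=
  csInf_le (bddBelow_netNorm u) ⟨a, h, rfl⟩

theorem netNorm_eq_zero_iff (hu : ∃ a, NetO u a) : netNorm u = 0 ↔ ∀ a, NetO u a := by
  constructor
  · intro h a
    obtain ⟨b, hb, hlt⟩ := netNorm_lt hu (h ▸ Real.exp_pos (-a))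
    exact hb.mono (by linarith [Real.exp_lt_exp.1 hlt])
  · intro h
    refine le_antisymm (le_of_forall_pos_le_add fun r hr => ?_) (netNorm_nonneg u)
    have := netNorm_le (h (-Real.log r))
    rwa [neg_neg, Real.exp_log hr, ← zero_add r] at this

theorem netNorm_neg (u : Idx → E) : netNorm (-u) = netNorm u := by
  have : {a : ℝ | NetO (-u) a} = {a : ℝ | NetO u a} := by
    ext a; exact ⟨fun h => by simpa using h.neg, fun h => h.neg⟩
  rw [netNorm, netNorm, this]

theorem netNorm_add_le (hu : ∃ a, NetO u a) (hv : ∃ a, NetO v a) :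
    netNorm (u + v) ≤ max (netNorm u) (netNorm v) := by
  refine le_of_forall_gt_imp_ge_of_dense fun r hr => ?_
  obtain ⟨a, ha, har⟩ := netNorm_lt hu ((le_max_left _ _).trans_lt hr)
  obtain ⟨b, hb, hbr⟩ := netNorm_lt hv ((le_max_right _ _).trans_lt hr)
  have h := netNorm_le ((ha.mono (min_le_left a b)).add (hb.mono (min_le_right a b)))
  rcases min_choice a b with h' | h' <;> rw [h'] at h <;> linarith

theorem netNorm_congr (h : ∀ a, NetO (u - v) a) : netNorm u = netNorm v := by
  have : {a : ℝ | NetO u a} = {a : ℝ | NetO v a} := by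
    ext a
    exact ⟨fun hu => by simpa using hu.sub (h a), fun hv => by simpa using (h a).add hv⟩
  rw [netNorm, netNorm, this]

end

/-! ### The ring of generalized complex numbers -/

/-- The ring `𝓔_M` of moderate nets of complex numbers. -/
def ModNum : Subring (Idx → ℂ) where
  carrier := {u | ∃ a : ℝ, NetO u a}
  mul_mem' := by rintro u v ⟨a, ha⟩ ⟨b, hb⟩; exact ⟨_, ha.mul hb⟩
  one_mem' := ⟨0, (isBigO_const_const (1 : ℂ) (one_ne_zero : (1 : ℝ) ≠ 0) toZero).congr_right
    fun ε => (Real.rpow_zero _).symm⟩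
  add_mem' := by
    rintro u v ⟨a, ha⟩ ⟨b, hb⟩
    exact ⟨min a b, (ha.mono (min_le_left a b)).add (hb.mono (min_le_right a b))⟩
  zero_mem' := ⟨0, NetO.zero 0⟩
  neg_mem' := by rintro u ⟨a, ha⟩; exact ⟨a, ha.neg⟩

/-- The ideal `𝓝₀` of null nets of complex numbers. -/
def NullNum : Ideal ModNum where
  carrier := {u | ∀ b : ℝ, NetO (u : Idx → ℂ) b}
  add_mem' := fun hu hv b => (hu b).add (hv b)
  zero_mem' := fun b => NetO.zero b
  smul_mem' := by
    rintro ⟨c, a, ha⟩ u hu b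
    have := ha.mul (hu (b - a))
    rwa [add_sub_cancel] at this

/-- The ring `ℂ̃ = 𝓔_M / 𝓝₀` of Colombeau generalized complex numbers. -/
def GenNum : Type := ModNum ⧸ NullNum

instance : CommRing GenNum := inferInstanceAs (CommRing (ModNum ⧸ NullNum))

/-- The class `[(u_ε)_ε]` of a moderate net of complex numbers. -/
def GenNum.mk (u : ModNum) : GenNum := Ideal.Quotient.mk NullNum u

theorem GenNum.mk_sub (u v : ModNum) : GenNum.mk u - GenNum.mk v = GenNum.mk (u - v) := rfl

theorem GenNum.mk_eq_mk {u v : ModNum} :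
    GenNum.mk u = GenNum.mk v ↔ ∀ b : ℝ, NetO ((u : Idx → ℂ) - (v : Idx → ℂ)) b :=
  Ideal.Quotient.eq

theorem GenNum.exists_rep (x : GenNum) : ∃ u, GenNum.mk u = x := Ideal.Quotient.mk_surjective x

/-- `e(x) = exp (-v(x))` on generalized complex numbers. -/
def GenNum.sharpNorm (x : GenNum) : ℝ :=
  Quotient.liftOn' x (fun u : ModNum => netNorm (u : Idx → ℂ)) fun u v h =>
    netNorm_congr (GenNum.mk_eq_mk.1 (Quotient.sound' h : GenNum.mk u = GenNum.mk v))

theorem GenNum.sharpNorm_mk (u : ModNum) :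
    (GenNum.mk u).sharpNorm = netNorm (u : Idx → ℂ) := rfl

/-- The sharp topology of `ℂ̃`: the ultrametric `e(x - y)`. -/
instance : MetricSpace GenNum where
  dist x y := (x - y).sharpNorm
  dist_self x := by
    obtain ⟨u, rfl⟩ := x.exists_rep
    rw [GenNum.mk_sub, sub_self, GenNum.sharpNorm_mk]
    exact (netNorm_eq_zero_iff (0 : ModNum).2).2 fun a => NetO.zero a
  dist_comm x y := by
    obtain ⟨u, rfl⟩ := x.exists_rep
    obtain ⟨v, rfl⟩ := y.exists_rep
    rw [GenNum.mk_sub, GenNum.mk_sub, ← neg_sub v u]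
    exact netNorm_neg _
  dist_triangle x y z := by
    obtain ⟨u, rfl⟩ := x.exists_rep
    obtain ⟨v, rfl⟩ := y.exists_rep
    obtain ⟨w, rfl⟩ := z.exists_rep
    rw [GenNum.mk_sub, GenNum.mk_sub, GenNum.mk_sub, ← sub_add_sub_cancel u v w]
    exact (netNorm_add_le (u - v).2 (v - w).2).trans
      (max_le_add_of_nonneg (netNorm_nonneg _) (netNorm_nonneg _))
  eq_of_dist_eq_zero := by
    intro x y h
    obtain ⟨u, rfl⟩ := x.exists_rep
    obtain ⟨v, rfl⟩ := y.exists_rep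
    exact GenNum.mk_eq_mk.2 ((netNorm_eq_zero_iff (u - v).2).1 h)

/-! ### Generalized points -/

/- Points of `ℂ^p` are functions `Fin p → ℂ`. The norm of `ℂ^p` enters only through `O`-estimates
and through compactness, so that the maximum norm of this type may replace the Euclidean one. -/

variable {p : ℕ}

/-- The set `Ω_M` of moderate nets of points of `Ω`. -/
def PointNet (Ω : TopologicalSpace.Opens (Fin p → ℂ)) : Type :=
  {x : Idx → (Fin p → ℂ) // (∀ ε, x ε ∈ Ω) ∧ ∃ a > 0, NetO x (-a)}

/-- The equivalence of nets of points: `|x_ε - y_ε| = O(ε^a)` for every `a > 0`. -/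
instance pointSetoid (Ω : TopologicalSpace.Opens (Fin p → ℂ)) : Setoid (PointNet Ω) where
  r x y := ∀ a > 0, NetO (x.1 - y.1) a
  iseqv :=
    { refl := fun x a _ => by rw [sub_self]; exact NetO.zero a
      symm := fun h a ha => by rw [← neg_sub]; exact (h a ha).neg
      trans := fun h h' a ha => by rw [← sub_add_sub_cancel]; exact (h a ha).add (h' a ha) }

/-- The set `Ω̃` of generalized points of `Ω`. -/
def GenPoint (Ω : TopologicalSpace.Opens (Fin p → ℂ)) : Type := Quotient (pointSetoid Ω)

variable {Ω : TopologicalSpace.Opens (Fin p → ℂ)}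

/-- The class of a moderate net of points of `Ω`. -/
def GenPoint.mk (x : PointNet Ω) : GenPoint Ω := Quotient.mk _ x

theorem PointNet.rel_all {x y : PointNet Ω} (h : ∀ a > 0, NetO (x.1 - y.1) a) (a : ℝ) :
    NetO (x.1 - y.1) a :=
  (h (max a 1) (by positivity)).mono (le_max_left _ _)

theorem GenPoint.mk_eq_mk {x y : PointNet Ω} :
    GenPoint.mk x = GenPoint.mk y ↔ ∀ a : ℝ, NetO (x.1 - y.1) a :=
  ⟨fun h => PointNet.rel_all (Quotient.exact h), fun h => Quotient.sound fun a _ => h a⟩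

theorem GenPoint.exists_rep (s : GenPoint Ω) : ∃ x, GenPoint.mk x = s := Quotient.exists_rep s

theorem PointNet.moderate_sub (x y : PointNet Ω) : ∃ a, NetO (x.1 - y.1) a := by
  obtain ⟨a, -, ha⟩ := x.2.2
  obtain ⟨b, -, hb⟩ := y.2.2
  exact ⟨min (-a) (-b), (ha.mono (min_le_left _ _)).sub (hb.mono (min_le_right _ _))⟩

/-- The ultrametric of `Ω̃`: `exp (-v(x - y))`. -/
def GenPoint.sharpDist (s t : GenPoint Ω) : ℝ :=
  Quotient.liftOn₂ s t (fun x y : PointNet Ω => netNorm (x.1 - y.1)) fun x y x' y' h h' =>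
    netNorm_congr fun a => by
      have := (PointNet.rel_all h a).sub (PointNet.rel_all h' a)
      rwa [sub_sub_sub_comm] at this

/-- The sharp topology of `Ω̃`. -/
instance : MetricSpace (GenPoint Ω) where
  dist := GenPoint.sharpDist
  dist_self s := by
    obtain ⟨x, rfl⟩ := s.exists_rep
    exact (netNorm_eq_zero_iff (x.moderate_sub x)).2 (GenPoint.mk_eq_mk.1 rfl)
  dist_comm s t := by
    obtain ⟨x, rfl⟩ := s.exists_rep
    obtain ⟨y, rfl⟩ := t.exists_rep
    change netNorm (x.1 - y.1) = netNorm (y.1 - x.1)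
    rw [← neg_sub, netNorm_neg]
  dist_triangle s t r := by
    obtain ⟨x, rfl⟩ := s.exists_rep
    obtain ⟨y, rfl⟩ := t.exists_rep
    obtain ⟨z, rfl⟩ := r.exists_rep
    change netNorm (x.1 - z.1) ≤ netNorm (x.1 - y.1) + netNorm (y.1 - z.1)
    rw [← sub_add_sub_cancel x.1 y.1 z.1]
    exact (netNorm_add_le (x.moderate_sub y) (y.moderate_sub z)).trans
      (max_le_add_of_nonneg (netNorm_nonneg _) (netNorm_nonneg _))
  eq_of_dist_eq_zero := by
    intro s t h
    obtain ⟨x, rfl⟩ := s.exists_rep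
    obtain ⟨y, rfl⟩ := t.exists_rep
    exact GenPoint.mk_eq_mk.2 ((netNorm_eq_zero_iff (x.moderate_sub y)).1 h)

theorem NetO.apply {x : Idx → (Fin p → ℂ)} {a : ℝ} (h : NetO x a) (i : Fin p) :
    NetO (fun ε => x ε i) a :=
  IsBigO.trans (IsBigO.of_bound 1 (Eventually.of_forall fun ε => by
    rw [one_mul]; exact norm_le_pi_norm (x ε) i)) h

/-- The `i`-th coordinate of a moderate net of points. -/
def PointNet.coord (x : PointNet Ω) (i : Fin p) : ModNum :=
  ⟨fun ε => x.1 ε i, by obtain ⟨a, -, ha⟩ := x.2.2; exact ⟨-a, ha.apply i⟩⟩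

/-- The `i`-th coordinate `s_i ∈ ℂ̃` of a generalized point `s`. -/
def GenPoint.coord (s : GenPoint Ω) (i : Fin p) : GenNum :=
  Quotient.liftOn s (fun x => GenNum.mk (x.coord i)) fun _ _ h =>
    GenNum.mk_eq_mk.2 fun a => (PointNet.rel_all h a).apply i

/-- `x_ε ∈ K` for all small `ε`, for some compact `K ⊆ Ω`. -/
def PointNet.IsCompactlySupported (x : PointNet Ω) : Prop :=
  ∃ K : Set (Fin p → ℂ), IsCompact K ∧ K ⊆ Ω ∧ ∀ᶠ ε in toZero, x.1 ε ∈ K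

/-- `s ∈ Ω̃_c`: the generalized point `s` has a compactly supported representative. -/
def GenPoint.IsCompactlySupported (s : GenPoint Ω) : Prop :=
  ∃ x : PointNet Ω, GenPoint.mk x = s ∧ x.IsCompactlySupported

/-! ### The algebra of generalized functions -/

/-- `sup_{x ∈ K} ‖D^n u_ε(x)‖ = O(ε^a)`, where `D^n` is the `n`-th real derivative on `Ω`, that is,
the collection of all partial derivatives of order `n`. -/
def DerivO (Ω : TopologicalSpace.Opens (Fin p → ℂ)) (K : Set (Fin p → ℂ)) (n : ℕ)
    (u : Idx → (Fin p → ℂ) → ℂ) (a : ℝ) : Prop :=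
  ∃ C : ℝ, ∀ᶠ ε in toZero, ∀ x ∈ K, ‖iteratedFDerivWithin ℝ n (u ε) Ω x‖ ≤ C * (ε : ℝ) ^ a

/-- Nets of functions that are smooth on `Ω`. -/
def SmoothNet (Ω : TopologicalSpace.Opens (Fin p → ℂ)) (u : Idx → (Fin p → ℂ) → ℂ) : Prop :=
  ∀ ε, ContDiffOn ℝ ∞ (u ε) Ω

section

variable {K : Set (Fin p → ℂ)} {n : ℕ} {u v : Idx → (Fin p → ℂ) → ℂ} {a b c : ℝ}

theorem DerivO.mono (h : DerivO Ω K n u b) (hab : a ≤ b) : DerivO Ω K n u a := by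
  obtain ⟨C, hC⟩ := h
  refine ⟨|C|, hC.mono fun ε h x hx => (h x hx).trans ?_⟩
  exact mul_le_mul (le_abs_self C) (rpow_anti ε hab) (Real.rpow_nonneg ε.2.1.le _) (abs_nonneg C)

theorem DerivO.zero (a : ℝ) : DerivO Ω K n 0 a :=
  ⟨0, Eventually.of_forall fun ε x _ => by
    simp only [Pi.zero_apply]
    rw [show (0 : (Fin p → ℂ) → ℂ) = fun _ => 0 from rfl, iteratedFDerivWithin_fun_zero]
    simp⟩

theorem DerivO.add (hK : K ⊆ Ω) (su : SmoothNet Ω u) (sv : SmoothNet Ω v)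
    (hu : DerivO Ω K n u a) (hv : DerivO Ω K n v a) : DerivO Ω K n (u + v) a := by
  obtain ⟨C, hC⟩ := hu
  obtain ⟨D, hD⟩ := hv
  refine ⟨C + D, ?_⟩
  filter_upwards [hC, hD] with ε h1 h2 x hx
  rw [Pi.add_apply, iteratedFDerivWithin_add_apply
    (((su ε) x (hK hx)).of_le (by exact_mod_cast le_top))
    (((sv ε) x (hK hx)).of_le (by exact_mod_cast le_top)) Ω.isOpen.uniqueDiffOn (hK hx), add_mul]
  exact (norm_add_le _ _).trans (add_le_add (h1 x hx) (h2 x hx))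

theorem DerivO.neg (hK : K ⊆ Ω) (hu : DerivO Ω K n u a) : DerivO Ω K n (-u) a := by
  obtain ⟨C, hC⟩ := hu
  refine ⟨C, hC.mono fun ε h x hx => ?_⟩
  rw [Pi.neg_apply, iteratedFDerivWithin_neg_apply Ω.isOpen.uniqueDiffOn (hK hx), norm_neg]
  exact h x hx

theorem DerivO.mul (hK : K ⊆ Ω) (su : SmoothNet Ω u) (sv : SmoothNet Ω v)
    (h : ∀ i ≤ n, ∃ a b, c ≤ a + b ∧ DerivO Ω K i u a ∧ DerivO Ω K (n - i) v b) :
    DerivO Ω K n (u * v) c := by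
  have key : ∀ i : ℕ, ∃ C : ℝ, i ≤ n → ∀ᶠ ε in toZero, ∀ x ∈ K,
      (n.choose i : ℝ) * ‖iteratedFDerivWithin ℝ i (u ε) Ω x‖ *
        ‖iteratedFDerivWithin ℝ (n - i) (v ε) Ω x‖ ≤ C * (ε : ℝ) ^ c := by
    intro i
    by_cases hi : i ≤ n
    swap
    · exact ⟨0, fun h => absurd h hi⟩
    obtain ⟨a, b, hab, ⟨C, hC⟩, ⟨D, hD⟩⟩ := h i hi
    refine ⟨n.choose i * |C| * |D|, fun _ => ?_⟩
    filter_upwards [hC, hD] with ε h1 h2 x hx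
    have e0 : 0 < (ε : ℝ) := ε.2.1
    have e1 : ‖iteratedFDerivWithin ℝ i (u ε) Ω x‖ ≤ |C| * (ε : ℝ) ^ a :=
      (h1 x hx).trans (mul_le_mul_of_nonneg_right (le_abs_self C) (Real.rpow_nonneg e0.le _))
    have e2 : ‖iteratedFDerivWithin ℝ (n - i) (v ε) Ω x‖ ≤ |D| * (ε : ℝ) ^ b :=
      (h2 x hx).trans (mul_le_mul_of_nonneg_right (le_abs_self D) (Real.rpow_nonneg e0.le _))
    calc _ ≤ (n.choose i : ℝ) * (|C| * (ε : ℝ) ^ a) * (|D| * (ε : ℝ) ^ b) := by gcongr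
      _ = n.choose i * |C| * |D| * (ε : ℝ) ^ (a + b) := by rw [Real.rpow_add e0]; ring
      _ ≤ _ := by
        have := rpow_anti ε hab
        gcongr
  choose C hC using key
  refine ⟨∑ i ∈ Finset.range (n + 1), C i, ?_⟩
  have hall : ∀ᶠ ε in toZero, ∀ i ∈ Finset.range (n + 1), ∀ x ∈ K,
      (n.choose i : ℝ) * ‖iteratedFDerivWithin ℝ i (u ε) Ω x‖ *
        ‖iteratedFDerivWithin ℝ (n - i) (v ε) Ω x‖ ≤ C i * (ε : ℝ) ^ c :=
    (Filter.eventually_all_finset _).2 fun i hi => hC i (Nat.lt_succ_iff.1 (Finset.mem_range.1 hi))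
  filter_upwards [hall] with ε hε x hx
  rw [Finset.sum_mul]
  exact (norm_iteratedFDerivWithin_mul_le (su ε) (sv ε) Ω.isOpen.uniqueDiffOn (hK hx)
    (by exact_mod_cast le_top)).trans (Finset.sum_le_sum fun i hi => hε i hi x hx)

end

/-- The ring `𝓔_M(Ω)` of moderate nets of smooth functions on `Ω`. Its elements are extended
arbitrarily outside `Ω`; the values there are forgotten in the quotient `𝓖(Ω)`. -/
def ModFun (Ω : TopologicalSpace.Opens (Fin p → ℂ)) : Subring (Idx → (Fin p → ℂ) → ℂ) where
  carrier := {u | SmoothNet Ω u ∧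
    ∀ K : Set (Fin p → ℂ), IsCompact K → K ⊆ Ω → ∀ n : ℕ, ∃ a : ℝ, DerivO Ω K n u a}
  mul_mem' := by
    rintro u v ⟨su, hu⟩ ⟨sv, hv⟩
    refine ⟨fun ε => (su ε).mul (sv ε), fun K hK hKΩ n => ?_⟩
    choose a ha using hu K hK hKΩ
    choose b hb using hv K hK hKΩ
    obtain ⟨c, hc⟩ := ((Finset.range (n + 1)).image fun i => a i + b (n - i)).bddBelow
    exact ⟨c, DerivO.mul hKΩ su sv fun i hi => ⟨a i, b (n - i),
      hc (Finset.mem_coe.2 <| Finset.mem_image_of_mem _ (Finset.mem_range.2 (Nat.lt_succ_of_le hi))), ha i, hb _⟩⟩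
  one_mem' := by
    refine ⟨fun ε => contDiffOn_const, fun K hK hKΩ n => ⟨0, 1, Eventually.of_forall fun ε x _ => ?_⟩⟩
    simp only [Pi.one_apply]
    rw [show (1 : (Fin p → ℂ) → ℂ) = fun _ => 1 from rfl]
    rcases Nat.eq_zero_or_pos n with rfl | hn
    · simp
    · rw [iteratedFDerivWithin_const_of_ne hn.ne']; simp
  add_mem' := by
    rintro u v ⟨su, hu⟩ ⟨sv, hv⟩
    refine ⟨fun ε => (su ε).add (sv ε), fun K hK hKΩ n => ?_⟩
    obtain ⟨a, ha⟩ := hu K hK hKΩ n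
    obtain ⟨b, hb⟩ := hv K hK hKΩ n
    exact ⟨min a b, DerivO.add hKΩ su sv (ha.mono (min_le_left a b)) (hb.mono (min_le_right a b))⟩
  zero_mem' := ⟨fun ε => contDiffOn_const, fun K _ _ n => ⟨0, DerivO.zero 0⟩⟩
  neg_mem' := by
    rintro u ⟨su, hu⟩
    refine ⟨fun ε => (su ε).neg, fun K hK hKΩ n => ?_⟩
    obtain ⟨a, ha⟩ := hu K hK hKΩ n
    exact ⟨a, ha.neg hKΩ⟩

/-- The ideal `𝓝(Ω)` of null nets. -/
def NullFun (Ω : TopologicalSpace.Opens (Fin p → ℂ)) : Ideal (ModFun Ω) where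
  carrier := {u | ∀ K : Set (Fin p → ℂ), IsCompact K → K ⊆ Ω → ∀ n : ℕ, ∀ b : ℝ,
    DerivO Ω K n (u : Idx → (Fin p → ℂ) → ℂ) b}
  add_mem' := by
    intro u v hu hv K hK hKΩ n b
    exact DerivO.add hKΩ u.2.1 v.2.1 (hu K hK hKΩ n b) (hv K hK hKΩ n b)
  zero_mem' := fun K _ _ n b => DerivO.zero b
  smul_mem' := by
    intro c u hu K hK hKΩ n b
    choose a ha using c.2.2 K hK hKΩ
    exact DerivO.mul hKΩ c.2.1 u.2.1 fun i _ =>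
      ⟨a i, b - a i, (add_sub_cancel _ _).ge, ha i, hu K hK hKΩ _ _⟩

/-- The (simplified) Colombeau algebra `𝓖(Ω) = 𝓔_M(Ω) / 𝓝(Ω)`. -/
def GenFun (Ω : TopologicalSpace.Opens (Fin p → ℂ)) : Type := ModFun Ω ⧸ NullFun Ω

instance : CommRing (GenFun Ω) := inferInstanceAs (CommRing (ModFun Ω ⧸ NullFun Ω))

/-- The class `[(u_ε)_ε]` of a moderate net of smooth functions. -/
def GenFun.mk (u : ModFun Ω) : GenFun Ω := Ideal.Quotient.mk (NullFun Ω) u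

theorem GenFun.exists_rep (f : GenFun Ω) : ∃ u, GenFun.mk u = f := Ideal.Quotient.mk_surjective f

theorem GenFun.mk_eq_mk {u v : ModFun Ω} : GenFun.mk u = GenFun.mk v ↔ u - v ∈ NullFun Ω :=
  Ideal.Quotient.eq

/-! ### Holomorphic generalized functions -/

/-- The real-linear map `L ↦ (L(e_i) + 𝐢 L(𝐢 e_i)) / 2`. -/
def dbarCLM (i : Fin p) : ((Fin p → ℂ) →L[ℝ] ℂ) →L[ℝ] ℂ :=
  (1 / 2 : ℂ) • (ContinuousLinearMap.apply ℝ ℂ (Pi.single i (1 : ℂ)) +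
    Complex.I • ContinuousLinearMap.apply ℝ ℂ (Pi.single i Complex.I))

/-- `∂̄_{z_i} g = (∂_{x_i} g + 𝐢 ∂_{y_i} g) / 2` on `Ω`. -/
def dbarFun (Ω : TopologicalSpace.Opens (Fin p → ℂ)) (i : Fin p) (g : (Fin p → ℂ) → ℂ)
    (z : Fin p → ℂ) : ℂ :=
  (1 / 2 : ℂ) * (fderivWithin ℝ g Ω z (Pi.single i 1) +
    Complex.I * fderivWithin ℝ g Ω z (Pi.single i Complex.I))

theorem dbarFun_eq (i : Fin p) (g : (Fin p → ℂ) → ℂ) :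
    dbarFun Ω i g = dbarCLM i ∘ fderivWithin ℝ g Ω := by
  funext z; simp [dbarFun, dbarCLM, mul_add]

/-- `∂̄_{z_i}` on moderate nets. -/
def dbarNet (i : Fin p) (u : ModFun Ω) : ModFun Ω :=
  ⟨fun ε => dbarFun Ω i (u.1 ε), by
    have hd : ∀ ε, ContDiffOn ℝ ∞ (fderivWithin ℝ (u.1 ε) Ω) Ω := fun ε =>
      (u.2.1 ε).fderivWithin Ω.isOpen.uniqueDiffOn (by simp)
    refine ⟨fun ε => ?_, fun K hK hKΩ n => ?_⟩
    · change ContDiffOn ℝ ∞ (dbarFun Ω i (u.1 ε)) Ω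
      rw [dbarFun_eq]
      exact (dbarCLM i).contDiff.comp_contDiffOn (hd ε)
    · obtain ⟨a, C, hC⟩ := u.2.2 K hK hKΩ (n + 1)
      refine ⟨a, ‖dbarCLM i‖ * C, hC.mono fun ε h x hx => ?_⟩
      change ‖iteratedFDerivWithin ℝ n (dbarFun Ω i (u.1 ε)) Ω x‖ ≤ _
      rw [dbarFun_eq]
      refine ((dbarCLM i).norm_iteratedFDerivWithin_comp_left ((hd ε) x (hKΩ hx))
        Ω.isOpen.uniqueDiffOn (hKΩ hx) (by exact_mod_cast le_top)).trans ?_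
      rw [norm_iteratedFDerivWithin_fderivWithin Ω.isOpen.uniqueDiffOn (hKΩ hx), mul_assoc]
      exact mul_le_mul_of_nonneg_left (h x hx) (norm_nonneg _)⟩

/-- `f` is a holomorphic generalized function: `∂̄_{z_i} f = 0` in `𝓖(Ω)` for all `i`, that is,
`(∂̄_{z_i} u_ε)_ε ∈ 𝓝(Ω)` for every representative `u` of `f`. -/
def GenFun.IsHolomorphic (f : GenFun Ω) : Prop :=
  ∀ u : ModFun Ω, GenFun.mk u = f → ∀ i : Fin p, dbarNet i u ∈ NullFun Ω

/-! ### Values at compactly supported generalized points -/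

/-- The net of values `u_ε(x_ε)` at a compactly supported net of points. -/
def evalNet (u : ModFun Ω) (x : PointNet Ω) (hx : x.IsCompactlySupported) : ModNum :=
  ⟨fun ε => u.1 ε (x.1 ε), by
    obtain ⟨K, hK, hKΩ, hxK⟩ := hx
    obtain ⟨a, C, hC⟩ := u.2.2 K hK hKΩ 0
    refine ⟨a, IsBigO.of_bound C ?_⟩
    filter_upwards [hC, hxK] with ε h1 h2
    have := h1 _ h2
    rw [norm_iteratedFDerivWithin_zero] at this
    rwa [Real.norm_of_nonneg (Real.rpow_nonneg ε.2.1.le _)]⟩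

/-- The value `f(s) = [(u_ε(x_ε))_ε]` at `s ∈ Ω̃_c`, where `u` represents `f` and `x` is a compactly
supported representative of `s`. By `GenFun.eval_eq` it does not depend on their choice. -/
def GenFun.eval (f : GenFun Ω) (s : GenPoint Ω) (hs : s.IsCompactlySupported) : GenNum :=
  GenNum.mk (evalNet f.exists_rep.choose hs.choose hs.choose_spec.2)

theorem tendsto_toZero : Tendsto (fun ε : Idx => (ε : ℝ)) toZero (𝓝 0) := tendsto_comap

theorem evalNet_congr_point (u : ModFun Ω) {x y : PointNet Ω} (hx : x.IsCompactlySupported)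
    (hy : y.IsCompactlySupported) (hxy : ∀ a, NetO (x.1 - y.1) a) :
    GenNum.mk (evalNet u x hx) = GenNum.mk (evalNet u y hy) := by
  refine GenNum.mk_eq_mk.2 fun b => ?_
  obtain ⟨K, hK, hKΩ, hxK⟩ := hx
  obtain ⟨δ, hδ, hδΩ⟩ := hK.exists_cthickening_subset_open Ω.isOpen hKΩ
  obtain ⟨a, C, hC⟩ := u.2.2 _ (hK.cthickening (r := δ)) hδΩ 1
  have hsmall : ∀ᶠ ε in toZero, ‖y.1 ε - x.1 ε‖ ≤ δ := by
    have h1 : Tendsto (fun ε : Idx => (ε : ℝ) ^ (1 : ℝ)) toZero (𝓝 0) := by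
      simpa using tendsto_toZero
    have h2 : Tendsto (x.1 - y.1) toZero (𝓝 0) := IsBigO.trans_tendsto (hxy 1) h1
    have h3 := h2.norm
    rw [norm_zero] at h3
    filter_upwards [h3.eventually (eventually_le_nhds hδ)] with ε h
    rw [norm_sub_rev]; exact h
  have hO : (fun ε => u.1 ε (x.1 ε) - u.1 ε (y.1 ε)) =O[toZero]
      fun ε : Idx => (ε : ℝ) ^ a * ‖(x.1 - y.1) ε‖ := by
    refine IsBigO.of_bound C ?_
    filter_upwards [hC, hxK, hsmall] with ε h1 h2 h3
    have hball : Metric.closedBall (x.1 ε) δ ⊆ Metric.cthickening δ K :=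
      Metric.closedBall_subset_cthickening h2 δ
    have hΩ : Metric.closedBall (x.1 ε) δ ⊆ (Ω : Set (Fin p → ℂ)) := hball.trans hδΩ
    have hdiff : DifferentiableOn ℝ (u.1 ε) Ω := (u.2.1 ε).differentiableOn (by simp)
    have hb : ∀ z ∈ Metric.closedBall (x.1 ε) δ, ‖fderiv ℝ (u.1 ε) z‖ ≤ C * (ε : ℝ) ^ a := by
      intro z hz
      have := h1 z (hball hz)
      rwa [← norm_iteratedFDerivWithin_fderivWithin (n := 0) Ω.isOpen.uniqueDiffOn (hΩ hz),
        norm_iteratedFDerivWithin_zero, fderivWithin_of_isOpen Ω.isOpen (hΩ hz)] at this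
    have := (convex_closedBall (x.1 ε) δ).norm_image_sub_le_of_norm_fderiv_le (𝕜 := ℝ)
      (fun z hz => (hdiff z (hΩ hz)).differentiableAt (Ω.isOpen.mem_nhds (hΩ hz))) hb
      (x := y.1 ε) (y := x.1 ε) (by rwa [mem_closedBall_iff_norm]) (Metric.mem_closedBall_self hδ.le)
    rw [Real.norm_of_nonneg (mul_nonneg (Real.rpow_nonneg ε.2.1.le _) (norm_nonneg _)), ← mul_assoc]
    exact this
  refine IsBigO.trans hO ?_
  have h4 := (isBigO_refl (fun ε : Idx => (ε : ℝ) ^ a) toZero).mul (hxy (b - a)).norm_left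
  refine h4.congr_right fun ε => ?_
  rw [← Real.rpow_add ε.2.1, add_sub_cancel]

theorem evalNet_congr_fun {u v : ModFun Ω} (huv : u - v ∈ NullFun Ω) {x : PointNet Ω}
    (hx : x.IsCompactlySupported) :
    GenNum.mk (evalNet u x hx) = GenNum.mk (evalNet v x hx) := by
  refine GenNum.mk_eq_mk.2 fun b => ?_
  obtain ⟨K, hK, hKΩ, hxK⟩ := id hx
  obtain ⟨C, hC⟩ := huv K hK hKΩ 0 b
  refine IsBigO.of_bound C ?_
  filter_upwards [hC, hxK] with ε h1 h2
  have := h1 _ h2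
  rw [norm_iteratedFDerivWithin_zero] at this
  rwa [Real.norm_of_nonneg (Real.rpow_nonneg ε.2.1.le _)]

theorem GenFun.eval_eq (u : ModFun Ω) (x : PointNet Ω) (hx : x.IsCompactlySupported)
    (hs : (GenPoint.mk x).IsCompactlySupported) :
    (GenFun.mk u).eval (GenPoint.mk x) hs = GenNum.mk (evalNet u x hx) :=
  (evalNet_congr_fun (GenFun.mk_eq_mk.1 (GenFun.mk u).exists_rep.choose_spec) _).trans
    (evalNet_congr_point u _ hx (GenPoint.mk_eq_mk.1 hs.choose_spec.1))

/-! ### S-holomorphic generalized functions -/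

/-- `(s - s₀)^n = ∏ i, (s_i - s₀_i)^(n_i)` for a multi-index `n`. -/
def GenPoint.subPow (s s₀ : GenPoint Ω) (n : Fin p → ℕ) : GenNum :=
  ∏ i, (s.coord i - s₀.coord i) ^ n i

/-- `f` is S-holomorphic at `s₀`: there are `a_n ∈ ℂ̃`, `n ∈ ℕ₀^p`, and a sharp neighbourhood `W`
of `s₀` in `Ω̃`, consisting of compactly supported points, such that for `s ∈ W` the series
`∑ a_n (s - s₀)^n` converges to `f(s)` in the sharp topology of `ℂ̃`. -/
def GenFun.IsSHolomorphicAt (f : GenFun Ω) (s₀ : GenPoint Ω) : Prop :=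
  ∃ a : (Fin p → ℕ) → GenNum, ∃ W ∈ 𝓝 s₀, ∃ hW : ∀ s ∈ W, s.IsCompactlySupported,
    ∀ (s : GenPoint Ω) (hs : s ∈ W), HasSum (fun n => a n * s.subPow s₀ n) (f.eval s (hW s hs))

/-- `f` is S-holomorphic in `Ω`: it is so at every compactly supported generalized point. -/
def GenFun.IsSHolomorphic (f : GenFun Ω) : Prop :=
  ∀ s₀ : GenPoint Ω, s₀.IsCompactlySupported → f.IsSHolomorphicAt s₀

end Colombeau

end

/-! Holomorphic implies S-holomorphic. The members of a representative are only approximately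
holomorphic: their `∂̄`-derivatives are null, not zero. Circle integrals nevertheless give the mean
value property and the Cauchy estimate up to errors controlled by bounds on `∂̄g` and `∂̄∂_z g`
(`norm_dz_le`), and these are null since `∂̄` commutes with `∂_z`. As the radius of the circles does
not depend on `ε`, every iterated derivative `∂_z^n u` is `O(ε^a)` near a compact set with the same
`a` as `u` (`HolO.dz`). At an increment of size at most `ε^b`, `b > 0`, the Taylor term of degree
`k` is then `O(ε^(a + k b))`, and the remainders obey similar bounds (`taylor_multi`). Sharp
convergence sees only orders in `ε`, so the Taylor series converges on a sharp ball.

S-holomorphic implies holomorphic. A moderate net of functions is null as soon as its values at all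
compactly supported points are (`mem_nullFun_of_eval`), so `∂̄_{z_i} u` need only be tested at a
point `x`. Along `x + τ ε^m e_i` with `|τ| = 1`, the power series gives `A₀ + A₁ τ ε^m` up to
`O(ε^(c + 2m))` (`expansion_shift`), while the real Taylor formula gives `u(x) + ∂_z u(x) τ ε^m +
∂̄u(x) τ̄ ε^m` up to `O(ε^(a + 2m))` (`taylor_shift`). Multiplying the difference by `τ` and summing
over `τ = ±1, ±𝐢` leaves `4 ε^m ∂̄u(x)`. Hence `∂̄u(x) = O(ε^(min a c + m))`. The exponents `a` and
`c` do not depend on `m`, which may be arbitrarily large. -/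

noncomputable section

namespace Colombeau

variable {p : ℕ} {Ω : TopologicalSpace.Opens (Fin p → ℂ)}

/-! ### First-order differential operators on nets -/

/-- The real-linear map `L ↦ (L(e_i) - 𝐢 L(𝐢 e_i)) / 2`. -/
def dzCLM (i : Fin p) : ((Fin p → ℂ) →L[ℝ] ℂ) →L[ℝ] ℂ :=
  (1 / 2 : ℂ) • (ContinuousLinearMap.apply ℝ ℂ (Pi.single i (1 : ℂ)) -
    Complex.I • ContinuousLinearMap.apply ℝ ℂ (Pi.single i Complex.I))

theorem dzCLM_apply (i : Fin p) (T : (Fin p → ℂ) →L[ℝ] ℂ) :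
    dzCLM i T = (1 / 2 : ℂ) * (T (Pi.single i 1) - Complex.I * T (Pi.single i Complex.I)) := by
  simp [dzCLM, mul_sub]

theorem dbarCLM_apply (i : Fin p) (T : (Fin p → ℂ) →L[ℝ] ℂ) :
    dbarCLM i T = (1 / 2 : ℂ) * (T (Pi.single i 1) + Complex.I * T (Pi.single i Complex.I)) := by
  simp [dbarCLM, mul_add]

/-- A real-linear map on a complex line is the sum of a complex-linear and an antilinear map;
`dzCLM` and `dbarCLM` read off the two coefficients. -/
theorem apply_single_eq (T : (Fin p → ℂ) →L[ℝ] ℂ) (i : Fin p) (w : ℂ) :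
    T (Pi.single i w) = dzCLM i T * w + dbarCLM i T * (starRingEnd ℂ) w := by
  have h : (Pi.single i w : Fin p → ℂ)
      = w.re • (Pi.single i 1 : Fin p → ℂ) + w.im • (Pi.single i Complex.I : Fin p → ℂ) := by
    rw [← Pi.single_smul, ← Pi.single_smul, ← Pi.single_add]
    congr 1
    simp
  rw [h, map_add, map_smul, map_smul, dzCLM_apply, dbarCLM_apply]
  have hI := Complex.I_sq
  have h1 : w = w.re + w.im * Complex.I := (Complex.re_add_im w).symm
  have h2 : (starRingEnd ℂ) w = w.re - w.im * Complex.I := by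
    apply Complex.ext <;> simp
  rw [h2]
  nth_rewrite 3 [h1]
  simp only [Complex.real_smul]
  linear_combination ((w.im : ℂ) * T (Pi.single i Complex.I)) * hI

theorem contDiffOn_fderivWithin {g : (Fin p → ℂ) → ℂ} (hg : ContDiffOn ℝ ∞ g Ω) :
    ContDiffOn ℝ ∞ (fderivWithin ℝ g Ω) Ω :=
  hg.fderivWithin Ω.isOpen.uniqueDiffOn (by simp)

theorem contDiffOn_comp_fderivWithin {g : (Fin p → ℂ) → ℂ} (hg : ContDiffOn ℝ ∞ g Ω)
    (L : ((Fin p → ℂ) →L[ℝ] ℂ) →L[ℝ] ℂ) : ContDiffOn ℝ ∞ (L ∘ fderivWithin ℝ g Ω) Ω :=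
  L.contDiff.comp_contDiffOn (contDiffOn_fderivWithin hg)

theorem DerivO.comp_fderivWithin {u : Idx → (Fin p → ℂ) → ℂ} {K : Set (Fin p → ℂ)} {n : ℕ} {a : ℝ}
    (su : SmoothNet Ω u) (hK : K ⊆ Ω) (h : DerivO Ω K (n + 1) u a)
    (L : ((Fin p → ℂ) →L[ℝ] ℂ) →L[ℝ] ℂ) :
    DerivO Ω K n (fun ε => L ∘ fderivWithin ℝ (u ε) Ω) a := by
  obtain ⟨C, hC⟩ := h
  refine ⟨‖L‖ * C, hC.mono fun ε h x hx => ?_⟩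
  refine (L.norm_iteratedFDerivWithin_comp_left (contDiffOn_fderivWithin (su ε) x (hK hx))
    Ω.isOpen.uniqueDiffOn (hK hx) (by exact_mod_cast le_top)).trans ?_
  rw [norm_iteratedFDerivWithin_fderivWithin Ω.isOpen.uniqueDiffOn (hK hx), mul_assoc]
  exact mul_le_mul_of_nonneg_left (h x hx) (norm_nonneg _)

/-- The net `(L(du_ε))_ε`. -/
def diffNet (L : ((Fin p → ℂ) →L[ℝ] ℂ) →L[ℝ] ℂ) (u : ModFun Ω) : ModFun Ω :=
  ⟨fun ε => L ∘ fderivWithin ℝ (u.1 ε) Ω, fun ε => contDiffOn_comp_fderivWithin (u.2.1 ε) L,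
    fun K hK hKΩ n => by
      obtain ⟨a, ha⟩ := u.2.2 K hK hKΩ (n + 1)
      exact ⟨a, ha.comp_fderivWithin u.2.1 hKΩ L⟩⟩

theorem diffNet_apply (L : ((Fin p → ℂ) →L[ℝ] ℂ) →L[ℝ] ℂ) (u : ModFun Ω) (ε : Idx)
    (z : Fin p → ℂ) : (diffNet L u).1 ε z = L (fderivWithin ℝ (u.1 ε) Ω z) := rfl

theorem dbarNet_eq (i : Fin p) (u : ModFun Ω) : dbarNet i u = diffNet (dbarCLM i) u :=
  Subtype.ext (funext fun ε => dbarFun_eq i (u.1 ε))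

theorem diffNet_mem_nullFun (L : ((Fin p → ℂ) →L[ℝ] ℂ) →L[ℝ] ℂ) {u : ModFun Ω}
    (hu : u ∈ NullFun Ω) : diffNet L u ∈ NullFun Ω :=
  fun K hK hKΩ n b => (hu K hK hKΩ (n + 1) b).comp_fderivWithin u.2.1 hKΩ L

theorem mem_nullFun_congr {u v : ModFun Ω} (hv : v ∈ NullFun Ω)
    (h : ∀ ε, ∀ z ∈ Ω, u.1 ε z = v.1 ε z) : u ∈ NullFun Ω := by
  intro K hK hKΩ n b
  obtain ⟨C, hC⟩ := hv K hK hKΩ n b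
  refine ⟨C, hC.mono fun ε hε x hx => ?_⟩
  have := iteratedFDerivWithin_congr (𝕜 := ℝ) (fun z hz => h ε z hz) (hKΩ hx) n
  rw [this]
  exact hε x hx

/-- Symmetry of the second derivative. This makes `∂̄∂_z g` null along with `∂̄g`, so that estimates
can be iterated over `∂_z`. -/
theorem dbar_dz_comm {g : (Fin p → ℂ) → ℂ} (hg : ContDiffOn ℝ ∞ g Ω) (i j : Fin p)
    {z : Fin p → ℂ} (hz : z ∈ Ω) :
    dbarCLM j (fderivWithin ℝ (dzCLM i ∘ fderivWithin ℝ g Ω) Ω z) =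
      dzCLM i (fderivWithin ℝ (dbarCLM j ∘ fderivWithin ℝ g Ω) Ω z) := by
  have hu : UniqueDiffWithinAt ℝ (Ω : Set (Fin p → ℂ)) z := Ω.isOpen.uniqueDiffWithinAt hz
  have hd : DifferentiableWithinAt ℝ (fderivWithin ℝ g Ω) Ω z :=
    (contDiffOn_fderivWithin hg).differentiableOn (by simp) z hz
  have hL : ∀ L : ((Fin p → ℂ) →L[ℝ] ℂ) →L[ℝ] ℂ, ∀ v,
      fderivWithin ℝ (L ∘ fderivWithin ℝ g Ω) Ω z v =
        L (fderivWithin ℝ (fderivWithin ℝ g Ω) Ω z v) := fun L v => by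
    rw [(L.hasFDerivAt.comp_hasFDerivWithinAt z hd.hasFDerivWithinAt).fderivWithin hu]
    rfl
  have hs : ∀ v w, fderivWithin ℝ (fderivWithin ℝ g Ω) Ω z v w =
      fderivWithin ℝ (fderivWithin ℝ g Ω) Ω z w v := by
    refine fun v w => ((hg z hz).isSymmSndFDerivWithinAt ?_ Ω.isOpen.uniqueDiffOn ?_ hz).eq v w
    · simpa using WithTop.coe_le_coe.2 (le_top : (2 : ℕ∞) ≤ ⊤)
    · rw [Ω.isOpen.interior_eq]
      exact subset_closure hz
  simp only [dzCLM_apply, dbarCLM_apply, hL]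
  rw [hs (Pi.single j 1) (Pi.single i 1), hs (Pi.single j 1) (Pi.single i Complex.I),
    hs (Pi.single j Complex.I) (Pi.single i 1),
    hs (Pi.single j Complex.I) (Pi.single i Complex.I)]
  ring

/-- All the derivatives `∂̄_{z_j} u` are null. -/
def DbarNull (u : ModFun Ω) : Prop := ∀ j : Fin p, diffNet (dbarCLM j) u ∈ NullFun Ω

theorem DbarNull.dz {u : ModFun Ω} (hu : DbarNull u) (i : Fin p) : DbarNull (diffNet (dzCLM i) u) :=
  fun j => mem_nullFun_congr (diffNet_mem_nullFun (dzCLM i) (hu j)) fun ε _ hz =>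
    dbar_dz_comm (u.2.1 ε) i j hz

/-- Chain rule in Wirtinger form; it is applied to radii, circles and segments in one coordinate
line. -/
theorem hasDerivAt_line {g : (Fin p → ℂ) → ℂ} (hg : ContDiffOn ℝ ∞ g Ω) (c : Fin p → ℂ) (i : Fin p)
    {γ : ℝ → ℂ} {γ' : ℂ} {t : ℝ} (hγ : HasDerivAt γ γ' t) (hz : c + Pi.single i (γ t) ∈ Ω) :
    HasDerivAt (fun t => g (c + Pi.single i (γ t)))
      (dzCLM i (fderivWithin ℝ g Ω (c + Pi.single i (γ t))) * γ' +
        dbarCLM i (fderivWithin ℝ g Ω (c + Pi.single i (γ t))) * (starRingEnd ℂ) γ') t := by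
  rw [← apply_single_eq]
  have h1 : HasFDerivAt g (fderivWithin ℝ g Ω (c + Pi.single i (γ t))) (c + Pi.single i (γ t)) := by
    rw [fderivWithin_of_isOpen Ω.isOpen hz]
    exact (((hg _ hz).contDiffAt (Ω.isOpen.mem_nhds hz)).differentiableAt (by simp)).hasFDerivAt
  have h2 : HasDerivAt (fun t => c + Pi.single i (γ t)) (Pi.single i γ') t := by
    refine HasDerivAt.const_add c ?_
    exact ((ContinuousLinearMap.single ℝ (fun _ : Fin p => ℂ) i).hasFDerivAt.comp_hasDerivAt t hγ)
  exact h1.comp_hasDerivAt t h2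

/-! ### Integrals over circles in a coordinate direction -/

/-- `exp(𝐢θ)`. -/
def unitExp (θ : ℝ) : ℂ := Complex.exp (θ * Complex.I)

theorem norm_unitExp (θ : ℝ) : ‖unitExp θ‖ = 1 := Complex.norm_exp_ofReal_mul_I θ

theorem hasDerivAt_unitExp (θ : ℝ) : HasDerivAt unitExp (Complex.I * unitExp θ) θ := by
  have h : HasDerivAt (fun θ : ℝ => (θ : ℂ) * Complex.I) Complex.I θ := by
    simpa using (Complex.ofRealCLM.hasDerivAt (x := θ)).mul_const Complex.I
  exact h.cexp.congr_deriv (mul_comm _ _)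

theorem continuous_unitExp : Continuous unitExp :=
  continuous_iff_continuousAt.2 fun θ => (hasDerivAt_unitExp θ).continuousAt

theorem unitExp_mul_conj (θ : ℝ) : unitExp θ * (starRingEnd ℂ) (unitExp θ) = 1 := by
  rw [Complex.mul_conj, Complex.normSq_eq_norm_sq, norm_unitExp]
  simp

theorem norm_mul_unitExp (t θ : ℝ) : ‖(t : ℂ) * unitExp θ‖ = |t| := by
  rw [norm_mul, norm_unitExp, mul_one, Complex.norm_real, Real.norm_eq_abs]

theorem unitExp_two_pi : unitExp (2 * Real.pi) = unitExp 0 := by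
  simp [unitExp]

theorem integral_unitExp : (∫ θ in (0 : ℝ)..(2 * Real.pi), unitExp θ) = 0 := by
  have := intervalIntegral.integral_eq_sub_of_hasDerivAt (a := 0) (b := 2 * Real.pi)
    (fun θ _ => hasDerivAt_unitExp θ)
    ((continuous_const.mul continuous_unitExp).intervalIntegrable _ _)
  rw [intervalIntegral.integral_const_mul, unitExp_two_pi, sub_self] at this
  exact (mul_eq_zero.1 this).resolve_left Complex.I_ne_zero

theorem integral_conj_unitExp :
    (∫ θ in (0 : ℝ)..(2 * Real.pi), (starRingEnd ℂ) (unitExp θ)) = 0 := by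
  have := (Complex.conjCLE : ℂ →L[ℝ] ℂ).intervalIntegral_comp_comm
    (continuous_unitExp.intervalIntegrable 0 (2 * Real.pi) (μ := MeasureTheory.volume))
  rw [integral_unitExp, map_zero] at this
  exact this

theorem add_single_mem_closedBall {c : Fin p → ℂ} (i : Fin p) {R : ℝ} {w : ℂ} (hw : ‖w‖ ≤ R) :
    c + Pi.single i w ∈ Metric.closedBall c R := by
  rw [mem_closedBall_iff_norm, add_sub_cancel_left, Pi.norm_single]
  exact hw

section

variable {c : Fin p → ℂ} {R : ℝ} (i : Fin p)

theorem continuous_comp_circle {h : (Fin p → ℂ) → ℂ} (hh : ContinuousOn h Ω)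
    (hR : Metric.closedBall c R ⊆ Ω) {t : ℝ} (ht : |t| ≤ R) :
    Continuous fun θ : ℝ => h (c + Pi.single i (t * unitExp θ)) := by
  refine hh.comp_continuous ?_ fun θ =>
    hR (add_single_mem_closedBall i ((norm_mul_unitExp t θ).trans_le ht))
  exact continuous_const.add
    ((ContinuousLinearMap.single ℝ (fun _ : Fin p => ℂ) i).continuous.comp
      (continuous_const.mul continuous_unitExp))

/-- Differentiation under the integral sign in the radius. The weight `κ` is `1` for the mean value
property and `exp(-𝐢θ)` for the Cauchy estimate. -/
theorem hasDerivAt_circle_integral {g : (Fin p → ℂ) → ℂ} (hg : ContDiffOn ℝ ∞ g Ω)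
    (hR : Metric.closedBall c R ⊆ Ω) {κ : ℝ → ℂ} (hκ : Continuous κ) {t : ℝ} (ht : |t| < R) :
    HasDerivAt (fun t : ℝ => ∫ θ in (0 : ℝ)..(2 * Real.pi),
        g (c + Pi.single i (t * unitExp θ)) * κ θ)
      (∫ θ in (0 : ℝ)..(2 * Real.pi),
        (dzCLM i (fderivWithin ℝ g Ω (c + Pi.single i (t * unitExp θ))) * unitExp θ +
          dbarCLM i (fderivWithin ℝ g Ω (c + Pi.single i (t * unitExp θ))) *
            (starRingEnd ℂ) (unitExp θ)) * κ θ) t := by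
  have hc1 := (contDiffOn_comp_fderivWithin hg (dzCLM i)).continuousOn
  have hc2 := (contDiffOn_comp_fderivWithin hg (dbarCLM i)).continuousOn
  have hcont : ∀ t : ℝ, |t| ≤ R → Continuous fun θ : ℝ =>
      (dzCLM i (fderivWithin ℝ g Ω (c + Pi.single i (t * unitExp θ))) * unitExp θ +
          dbarCLM i (fderivWithin ℝ g Ω (c + Pi.single i (t * unitExp θ))) *
            (starRingEnd ℂ) (unitExp θ)) * κ θ := fun t ht =>
    (((continuous_comp_circle i hc1 hR ht).mul continuous_unitExp).add
      ((continuous_comp_circle i hc2 hR ht).mul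
        (Complex.continuous_conj.comp continuous_unitExp))).mul hκ
  obtain ⟨M1, hM1⟩ := (isCompact_closedBall c R).exists_bound_of_continuousOn (hc1.mono hR)
  obtain ⟨M2, hM2⟩ := (isCompact_closedBall c R).exists_bound_of_continuousOn (hc2.mono hR)
  have hU : {t : ℝ | |t| < R} ∈ 𝓝 t := (isOpen_lt continuous_abs continuous_const).mem_nhds ht
  refine (intervalIntegral.hasDerivAt_integral_of_dominated_loc_of_deriv_le
    (F := fun (t : ℝ) θ => g (c + Pi.single i (t * unitExp θ)) * κ θ)
    (F' := fun (t : ℝ) θ =>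
      (dzCLM i (fderivWithin ℝ g Ω (c + Pi.single i (t * unitExp θ))) * unitExp θ +
          dbarCLM i (fderivWithin ℝ g Ω (c + Pi.single i (t * unitExp θ))) *
            (starRingEnd ℂ) (unitExp θ)) * κ θ)
    (bound := fun θ => (M1 + M2) * ‖κ θ‖) hU ?_ ?_ ?_ ?_ ?_ ?_).2
  · filter_upwards [hU] with s hs
    exact ((continuous_comp_circle i hg.continuousOn hR (le_of_lt hs)).mul hκ).aestronglyMeasurable
  · exact ((continuous_comp_circle i hg.continuousOn hR ht.le).mul hκ).intervalIntegrable _ _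
  · exact (hcont t ht.le).aestronglyMeasurable
  · refine Eventually.of_forall fun θ _ s hs => ?_
    have hz : c + Pi.single i (s * unitExp θ) ∈ Metric.closedBall c R :=
      add_single_mem_closedBall i ((norm_mul_unitExp s θ).trans_le (le_of_lt hs))
    rw [norm_mul]
    refine mul_le_mul_of_nonneg_right ((norm_add_le _ _).trans (add_le_add ?_ ?_)) (norm_nonneg _)
    · rw [norm_mul, norm_unitExp, mul_one]
      exact hM1 _ hz
    · rw [norm_mul, RCLike.norm_conj, norm_unitExp, mul_one]
      exact hM2 _ hz
  · exact (Continuous.mul (continuous_const (y := M1 + M2)) hκ.norm).intervalIntegrable _ _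
  · refine Eventually.of_forall fun θ _ s hs => ?_
    have hz : c + Pi.single i (s * unitExp θ) ∈ Metric.closedBall c R :=
      add_single_mem_closedBall i ((norm_mul_unitExp s θ).trans_le (le_of_lt hs))
    have h1 : HasDerivAt (fun s : ℝ => (s : ℂ) * unitExp θ) (unitExp θ) s := by
      simpa using (Complex.ofRealCLM.hasDerivAt (x := s)).mul_const (unitExp θ)
    exact (hasDerivAt_line hg c i h1 (hR hz)).mul_const (κ θ)

/-- The circle integral of `∂_z g` over `w = t exp(𝐢θ)` against `exp(𝐢θ) dθ` is that of `∂̄_z g`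
against `exp(-𝐢θ) dθ`. -/
theorem circle_integral_dz_eq {g : (Fin p → ℂ) → ℂ} (hg : ContDiffOn ℝ ∞ g Ω)
    (hR : Metric.closedBall c R ⊆ Ω) {t : ℝ} (ht : |t| ≤ R) :
    (∫ θ in (0 : ℝ)..(2 * Real.pi),
        dzCLM i (fderivWithin ℝ g Ω (c + Pi.single i (t * unitExp θ))) * unitExp θ) =
      ∫ θ in (0 : ℝ)..(2 * Real.pi),
        dbarCLM i (fderivWithin ℝ g Ω (c + Pi.single i (t * unitExp θ))) *
          (starRingEnd ℂ) (unitExp θ) := by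
  have hc1 := (contDiffOn_comp_fderivWithin hg (dzCLM i)).continuousOn
  have hc2 := (contDiffOn_comp_fderivWithin hg (dbarCLM i)).continuousOn
  have k1 : Continuous fun θ : ℝ =>
      dzCLM i (fderivWithin ℝ g Ω (c + Pi.single i (t * unitExp θ))) * unitExp θ :=
    (continuous_comp_circle i hc1 hR ht).mul continuous_unitExp
  have k2 : Continuous fun θ : ℝ =>
      dbarCLM i (fderivWithin ℝ g Ω (c + Pi.single i (t * unitExp θ))) *
        (starRingEnd ℂ) (unitExp θ) :=
    (continuous_comp_circle i hc2 hR ht).mul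
        (Complex.continuous_conj.comp continuous_unitExp)
  -- The `θ`-derivative below carries a factor `t`, so the degenerate circle is treated apart: there
  -- both integrands are constants times `exp(±𝐢θ)`.
  rcases eq_or_ne t 0 with rfl | ht0
  · have e1 := integral_unitExp
    have e2 := integral_conj_unitExp
    simp only [Complex.ofReal_zero, zero_mul, Pi.single_zero, add_zero,
      intervalIntegral.integral_const_mul, e1, e2, mul_zero]
  -- The integral of this derivative over a full period vanishes, and up to the factor `t𝐢` it is
  -- the difference of the two sides.
  · have hd : ∀ θ : ℝ, HasDerivAt (fun θ : ℝ => g (c + Pi.single i ((t : ℂ) * unitExp θ)))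
        ((t * Complex.I) * (dzCLM i (fderivWithin ℝ g Ω (c + Pi.single i (t * unitExp θ))) *
          unitExp θ - dbarCLM i (fderivWithin ℝ g Ω (c + Pi.single i (t * unitExp θ))) *
          (starRingEnd ℂ) (unitExp θ))) θ := fun θ => by
      have hz : c + Pi.single i (t * unitExp θ) ∈ Ω :=
        hR (add_single_mem_closedBall i ((norm_mul_unitExp t θ).trans_le ht))
      refine (hasDerivAt_line hg c i ((hasDerivAt_unitExp θ).const_mul (t : ℂ)) hz).congr_deriv ?_
      simp only [map_mul, Complex.conj_ofReal, Complex.conj_I]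
      ring
    have := intervalIntegral.integral_eq_sub_of_hasDerivAt (a := 0) (b := 2 * Real.pi)
      (fun θ _ => hd θ) ((continuous_const.mul (k1.sub k2)).intervalIntegrable _ _)
    rw [intervalIntegral.integral_const_mul, unitExp_two_pi, sub_self,
      intervalIntegral.integral_sub (k1.intervalIntegrable _ _) (k2.intervalIntegrable _ _)] at this
    have h0 : (t : ℂ) * Complex.I ≠ 0 :=
      mul_ne_zero (Complex.ofReal_ne_zero.2 ht0) Complex.I_ne_zero
    exact sub_eq_zero.1 ((mul_eq_zero.1 this).resolve_left h0)

/-- An approximate mean value property. -/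
theorem norm_circle_integral_sub_le {g : (Fin p → ℂ) → ℂ} (hg : ContDiffOn ℝ ∞ g Ω)
    (hR : Metric.closedBall c R ⊆ Ω) {B : ℝ}
    (hB : ∀ z ∈ Metric.closedBall c R, ‖dbarCLM i (fderivWithin ℝ g Ω z)‖ ≤ B)
    {t : ℝ} (ht0 : 0 ≤ t) (ht : t < R) :
    ‖(∫ θ in (0 : ℝ)..(2 * Real.pi), g (c + Pi.single i (t * unitExp θ))) - 2 * Real.pi * g c‖ ≤
      4 * Real.pi * B * t := by
  have hB0 : 0 ≤ B := (norm_nonneg _).trans (hB c (Metric.mem_closedBall_self (ht0.trans ht.le)))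
  have hc1 := (contDiffOn_comp_fderivWithin hg (dzCLM i)).continuousOn
  have hc2 := (contDiffOn_comp_fderivWithin hg (dbarCLM i)).continuousOn
  -- The radial derivative is the sum of the two integrals equated by `circle_integral_dz_eq`, hence
  -- twice the one containing `∂̄g`.
  have hd : ∀ s ∈ Set.Icc 0 t, HasDerivWithinAt
      (fun t : ℝ => ∫ θ in (0 : ℝ)..(2 * Real.pi), g (c + Pi.single i (t * unitExp θ)))
      (2 * ∫ θ in (0 : ℝ)..(2 * Real.pi),
        dbarCLM i (fderivWithin ℝ g Ω (c + Pi.single i (s * unitExp θ))) *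
            (starRingEnd ℂ) (unitExp θ)) (Set.Icc 0 t) s := by
    intro s hs
    have hs' : |s| < R := by rw [abs_of_nonneg hs.1]; linarith [hs.2]
    have := hasDerivAt_circle_integral i hg hR (continuous_const (y := (1 : ℂ))) hs'
    simp only [mul_one] at this
    rw [intervalIntegral.integral_add, circle_integral_dz_eq i hg hR hs'.le, ← two_mul] at this
    · exact this.hasDerivWithinAt
    · exact ((continuous_comp_circle i hc1 hR hs'.le).mul continuous_unitExp).intervalIntegrable _ _
    · exact ((continuous_comp_circle i hc2 hR hs'.le).mul
        (Complex.continuous_conj.comp continuous_unitExp)).intervalIntegrable _ _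
  have hb : ∀ s ∈ Set.Ico 0 t, ‖2 * ∫ θ in (0 : ℝ)..(2 * Real.pi),
        dbarCLM i (fderivWithin ℝ g Ω (c + Pi.single i (s * unitExp θ))) *
            (starRingEnd ℂ) (unitExp θ)‖ ≤ 4 * Real.pi * B := by
    intro s hs
    have hs' : |s| ≤ R := by rw [abs_of_nonneg hs.1]; linarith [hs.2]
    have := intervalIntegral.norm_integral_le_of_norm_le_const (a := 0) (b := 2 * Real.pi) (C := B)
      (f := fun θ : ℝ => dbarCLM i (fderivWithin ℝ g Ω (c + Pi.single i (s * unitExp θ))) *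
            (starRingEnd ℂ) (unitExp θ)) fun θ _ => by
        rw [norm_mul, RCLike.norm_conj, norm_unitExp, mul_one]
        exact hB _ (add_single_mem_closedBall i ((norm_mul_unitExp s θ).trans_le hs'))
    rw [sub_zero, abs_of_pos Real.two_pi_pos] at this
    rw [norm_mul, Complex.norm_ofNat]
    linarith
  have := norm_image_sub_le_of_norm_deriv_le_segment' hd hb t (Set.right_mem_Icc.2 ht0)
  simpa using this

/-- An approximate Cauchy estimate. -/
theorem norm_dz_le {g : (Fin p → ℂ) → ℂ} (hg : ContDiffOn ℝ ∞ g Ω)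
    (hR : Metric.closedBall c R ⊆ Ω) {A B B' : ℝ}
    (hA : ∀ z ∈ Metric.closedBall c R, ‖g z‖ ≤ A)
    (hB : ∀ z ∈ Metric.closedBall c R, ‖dbarCLM i (fderivWithin ℝ g Ω z)‖ ≤ B)
    (hB' : ∀ z ∈ Metric.closedBall c R,
      ‖dbarCLM i (fderivWithin ℝ (dzCLM i ∘ fderivWithin ℝ g Ω) Ω z)‖ ≤ B')
    {r : ℝ} (hr0 : 0 < r) (hr : r < R) :
    r * ‖dzCLM i (fderivWithin ℝ g Ω c)‖ ≤ A + (B + 2 * B' * r) * r := by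
  have hB0 : 0 ≤ B' := (norm_nonneg _).trans (hB' c (Metric.mem_closedBall_self (hr0.trans hr).le))
  have hc1 := (contDiffOn_comp_fderivWithin hg (dzCLM i)).continuousOn
  have hc2 := (contDiffOn_comp_fderivWithin hg (dbarCLM i)).continuousOn
  have hk : Continuous fun θ => (starRingEnd ℂ) (unitExp θ) :=
    Complex.continuous_conj.comp continuous_unitExp
  set D : ℂ := dzCLM i (fderivWithin ℝ g Ω c) with hD
  -- With the weight `exp(-𝐢θ)` the radial derivative contains the plain circle mean of `∂_z g`,
  -- which the mean value property compares with `2πD`; subtracting `2πtD` leaves only `∂̄`-errors.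
  have hd : ∀ s ∈ Set.Icc 0 r, HasDerivWithinAt
      (fun t : ℝ => (∫ θ in (0 : ℝ)..(2 * Real.pi),
        g (c + Pi.single i (t * unitExp θ)) * (starRingEnd ℂ) (unitExp θ)) - t * (2 * Real.pi * D))
      ((∫ θ in (0 : ℝ)..(2 * Real.pi),
        (dzCLM i ∘ fderivWithin ℝ g Ω) (c + Pi.single i (s * unitExp θ))) - 2 * Real.pi * D +
        ∫ θ in (0 : ℝ)..(2 * Real.pi),
        dbarCLM i (fderivWithin ℝ g Ω (c + Pi.single i (s * unitExp θ))) *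
            (starRingEnd ℂ) (unitExp θ) * (starRingEnd ℂ) (unitExp θ)) (Set.Icc 0 r) s := by
    intro s hs
    have hs' : |s| < R := by rw [abs_of_nonneg hs.1]; linarith [hs.2]
    have h1 := hasDerivAt_circle_integral i hg hR hk hs'
    have h2 : HasDerivAt (fun t : ℝ => (t : ℂ) * (2 * Real.pi * D)) (2 * Real.pi * D) s := by
      simpa using (Complex.ofRealCLM.hasDerivAt (x := s)).mul_const (2 * Real.pi * D)
    refine ((h1.sub h2).congr_deriv ?_).hasDerivWithinAt
    rw [sub_add_eq_add_sub, ← intervalIntegral.integral_add]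
    · congr 1
      refine intervalIntegral.integral_congr fun θ _ => ?_
      simp only [add_mul, Function.comp_apply]
      rw [mul_assoc _ (unitExp θ), unitExp_mul_conj, mul_one]
    · exact (continuous_comp_circle i hc1 hR hs'.le).intervalIntegrable _ _
    · exact (((continuous_comp_circle i hc2 hR hs'.le).mul hk).mul hk).intervalIntegrable _ _
  have hb : ∀ s ∈ Set.Ico 0 r, ‖(∫ θ in (0 : ℝ)..(2 * Real.pi),
        (dzCLM i ∘ fderivWithin ℝ g Ω) (c + Pi.single i (s * unitExp θ))) - 2 * Real.pi * D +
        ∫ θ in (0 : ℝ)..(2 * Real.pi),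
        dbarCLM i (fderivWithin ℝ g Ω (c + Pi.single i (s * unitExp θ))) *
            (starRingEnd ℂ) (unitExp θ) * (starRingEnd ℂ) (unitExp θ)‖ ≤
        2 * Real.pi * (B + 2 * B' * r) := by
    intro s hs
    have hs' : |s| ≤ R := by rw [abs_of_nonneg hs.1]; linarith [hs.2]
    have h1 := intervalIntegral.norm_integral_le_of_norm_le_const (a := 0) (b := 2 * Real.pi)
      (C := B) (f := fun θ : ℝ => dbarCLM i (fderivWithin ℝ g Ω (c + Pi.single i (s * unitExp θ))) *
            (starRingEnd ℂ) (unitExp θ) * (starRingEnd ℂ) (unitExp θ)) fun θ _ => by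
        rw [norm_mul, norm_mul, RCLike.norm_conj, norm_unitExp, mul_one, mul_one]
        exact hB _ (add_single_mem_closedBall i ((norm_mul_unitExp s θ).trans_le hs'))
    rw [sub_zero, abs_of_pos Real.two_pi_pos] at h1
    have h2 := norm_circle_integral_sub_le i (contDiffOn_comp_fderivWithin hg (dzCLM i)) hR hB'
      hs.1 (hs.2.trans hr)
    have h3 : 4 * Real.pi * B' * s ≤ 4 * Real.pi * B' * r :=
      mul_le_mul_of_nonneg_left hs.2.le (by positivity)
    refine (norm_add_le _ _).trans ((add_le_add h2 h1).trans ?_)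
    linarith
  have h4 := norm_image_sub_le_of_norm_deriv_le_segment' hd hb r (Set.right_mem_Icc.2 hr0.le)
  have h5 : (∫ θ in (0 : ℝ)..(2 * Real.pi),
      g (c + Pi.single i (((0 : ℝ) : ℂ) * unitExp θ)) * (starRingEnd ℂ) (unitExp θ)) = 0 := by
    have e2 := integral_conj_unitExp
    simp only [Complex.ofReal_zero, zero_mul, Pi.single_zero, add_zero,
      intervalIntegral.integral_const_mul, e2, mul_zero]
  have h6 := intervalIntegral.norm_integral_le_of_norm_le_const (a := 0) (b := 2 * Real.pi)
      (C := A) (f := fun θ : ℝ => g (c + Pi.single i (r * unitExp θ)) * (starRingEnd ℂ) (unitExp θ))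
      fun θ _ => by
        rw [norm_mul, RCLike.norm_conj, norm_unitExp, mul_one]
        exact hA _ (add_single_mem_closedBall i ((norm_mul_unitExp r θ).trans_le
          (by rw [abs_of_pos hr0]; exact hr.le)))
  rw [sub_zero, abs_of_pos Real.two_pi_pos] at h6
  rw [h5] at h4
  simp only [Complex.ofReal_zero, zero_mul, sub_zero] at h4
  have h7 : ‖(r : ℂ) * (2 * Real.pi * D)‖ = 2 * Real.pi * (r * ‖D‖) := by
    simp only [norm_mul, Complex.norm_real, Complex.norm_ofNat, Real.norm_eq_abs,
      abs_of_pos hr0, abs_of_pos Real.pi_pos]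
    ring
  have h8 := norm_sub_norm_le ((r : ℂ) * (2 * Real.pi * D))
    (∫ θ in (0 : ℝ)..(2 * Real.pi),
      g (c + Pi.single i (r * unitExp θ)) * (starRingEnd ℂ) (unitExp θ))
  rw [norm_sub_rev] at h8
  have h9 : 2 * Real.pi * (r * ‖D‖) ≤ 2 * Real.pi * (A + (B + 2 * B' * r) * r) := by
    linarith
  exact le_of_mul_le_mul_left h9 Real.two_pi_pos

end

/-! ### Taylor expansion of nets with null `∂̄`-derivatives -/

theorem derivO_zero_iff {K : Set (Fin p → ℂ)} {u : Idx → (Fin p → ℂ) → ℂ} {a : ℝ} :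
    DerivO Ω K 0 u a ↔ ∃ C : ℝ, ∀ᶠ ε in toZero, ∀ x ∈ K, ‖u ε x‖ ≤ C * (ε : ℝ) ^ a := by
  simp only [DerivO, norm_iteratedFDerivWithin_zero]

theorem tendsto_rpow_toZero {b : ℝ} (hb : 0 < b) :
    Tendsto (fun ε : Idx => (ε : ℝ) ^ b) toZero (𝓝 0) := by
  have := tendsto_toZero.rpow_const (p := b) (Or.inr hb.le)
  rwa [Real.zero_rpow hb.ne'] at this

theorem NetO.tendsto_zero {E : Type*} [NormedAddCommGroup E] {h : Idx → E} {b : ℝ} (hb : 0 < b)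
    (hh : NetO h b) : Tendsto h toZero (𝓝 0) :=
  IsBigO.trans_tendsto hh (tendsto_rpow_toZero hb)

theorem closedBall_subset_cthickening_two {K : Set (Fin p → ℂ)} {δ : ℝ} (hδ : 0 < δ)
    {x : Fin p → ℂ} (hx : x ∈ Metric.cthickening (δ / 2) K) :
    Metric.closedBall x (δ / 2) ⊆ Metric.cthickening δ K := by
  refine (Metric.closedBall_subset_cthickening hx (δ / 2)).trans ?_
  have := Metric.cthickening_cthickening_subset (half_pos hδ).le (half_pos hδ).le K
  rwa [add_halves] at this

/-- The points `x_ε` are eventually in every neighbourhood of the compact set `K`. -/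
def Near (K : Set (Fin p → ℂ)) (x : Idx → (Fin p → ℂ)) : Prop :=
  ∀ δ > 0, ∀ᶠ ε in toZero, x ε ∈ Metric.cthickening δ K

theorem Near.of_mem {K : Set (Fin p → ℂ)} {x : Idx → (Fin p → ℂ)}
    (h : ∀ᶠ ε in toZero, x ε ∈ K) : Near K x :=
  fun _ _ => h.mono fun _ hε => Metric.self_subset_cthickening K hε

/-- Expanding one coordinate at a time moves the base point off `K`, but only by increments tending
to zero. -/
theorem Near.add {K : Set (Fin p → ℂ)} {x h : Idx → (Fin p → ℂ)} (hx : Near K x)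
    (hh : Tendsto h toZero (𝓝 0)) : Near K (x + h) := by
  intro δ hδ
  have h1 := hh.norm
  rw [norm_zero] at h1
  filter_upwards [hx (δ / 2) (half_pos hδ), h1.eventually (eventually_le_nhds (half_pos hδ))]
    with ε h2 h3
  refine closedBall_subset_cthickening_two hδ h2 ?_
  rw [mem_closedBall_iff_norm, Pi.add_apply, add_sub_cancel_left]
  exact h3

/-- `u` has null `∂̄`-derivatives and is `O(ε^a)` near `K`. -/
def HolO (K : Set (Fin p → ℂ)) (a : ℝ) (u : ModFun Ω) : Prop :=
  DbarNull u ∧ ∃ δ > 0, Metric.cthickening δ K ⊆ Ω ∧ DerivO Ω (Metric.cthickening δ K) 0 u.1 a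

/-- The exponent survives because the Cauchy estimate is used with the fixed radius `δ/4`, and the
null `∂̄`-terms may be taken `O(ε^a)` too. Only the neighbourhood shrinks, from `δ` to `δ/2`. -/
theorem HolO.dz {K : Set (Fin p → ℂ)} (hK : IsCompact K) {a : ℝ} {u : ModFun Ω} (hu : HolO K a u)
    (i : Fin p) : HolO K a (diffNet (dzCLM i) u) := by
  obtain ⟨hn, δ, hδ, hδΩ, hO⟩ := hu
  refine ⟨hn.dz i, δ / 2, half_pos hδ,
    (Metric.cthickening_mono (half_le_self hδ.le) K).trans hδΩ, derivO_zero_iff.2 ?_⟩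
  obtain ⟨C, hC⟩ := derivO_zero_iff.1 hO
  obtain ⟨C₁, hC₁⟩ := derivO_zero_iff.1 (hn i _ (hK.cthickening (r := δ)) hδΩ 0 a)
  obtain ⟨C₂, hC₂⟩ := derivO_zero_iff.1 (hn.dz i i _ (hK.cthickening (r := δ)) hδΩ 0 a)
  refine ⟨(C + (C₁ + 2 * C₂ * (δ / 4)) * (δ / 4)) / (δ / 4), ?_⟩
  filter_upwards [hC, hC₁, hC₂] with ε h h₁ h₂ x hx
  have hb := closedBall_subset_cthickening_two hδ hx
  have := norm_dz_le i (u.2.1 ε) (hb.trans hδΩ) (fun z hz => h z (hb hz))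
    (fun z hz => h₁ z (hb hz)) (fun z hz => h₂ z (hb hz)) (r := δ / 4) (by positivity)
    (by linarith)
  rw [diffNet_apply, div_mul_eq_mul_div, le_div_iff₀ (by positivity)]
  linarith

theorem HolO.dz_iterate {K : Set (Fin p → ℂ)} (hK : IsCompact K) {a : ℝ} {u : ModFun Ω}
    (hu : HolO K a u) (i : Fin p) (k : ℕ) : HolO K a ((diffNet (dzCLM i))^[k] u) := by
  induction k generalizing u with
  | zero => exact hu
  | succ k ih =>
    rw [Function.iterate_succ_apply]
    exact ih (hu.dz hK i)

/-! ### Taylor's formula in one coordinate -/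

theorem hasDerivAt_taylor_poly (A : ℕ → ℂ) (w : ℂ) (N : ℕ) (t : ℝ) :
    HasDerivAt (fun t : ℝ => ∑ k ∈ Finset.range (N + 1), A k * ((t * w) ^ k / k.factorial))
      (w * ∑ k ∈ Finset.range N, A (k + 1) * ((t * w) ^ k / k.factorial)) t := by
  simp only [Finset.sum_range_succ' _ N, pow_zero, Finset.mul_sum]
  refine (HasDerivAt.fun_sum fun k _ => ?_).add_const _
  have h1 : HasDerivAt (fun t : ℝ => (t : ℂ) * w) w t := by
    simpa using (Complex.ofRealCLM.hasDerivAt (x := t)).mul_const w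
  refine (((h1.pow (k + 1)).div_const ((k + 1).factorial : ℂ)).const_mul (A (k + 1))).congr_deriv ?_
  have h2 : (k.factorial : ℂ) ≠ 0 := Nat.cast_ne_zero.2 k.factorial_ne_zero
  have h3 : (k : ℂ) + 1 ≠ 0 := Nat.cast_add_one_ne_zero k
  simp only [Nat.factorial_succ, Nat.cast_mul, Nat.cast_add, Nat.cast_one, Nat.add_sub_cancel]
  field_simp

/-- Along the segment `t ↦ x + t w e_i`, the derivative of the remainder of order `N + 1` is `w`
times the remainder of order `N` of `∂_z u`, plus a null term. Each integration thus gains a factor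
`ε^b`. -/
theorem taylor_single {K : Set (Fin p → ℂ)} (hK : IsCompact K) {a b : ℝ} (hb : 0 < b)
    {x : Idx → (Fin p → ℂ)} (hx : Near K x) (i : Fin p) (N : ℕ) {u : ModFun Ω} (hu : HolO K a u) :
    ∃ C : ℝ, ∀ᶠ ε : Idx in toZero, ∀ w : ℂ, ‖w‖ ≤ (ε : ℝ) ^ b →
      ‖u.1 ε (x ε + Pi.single i w) - ∑ k ∈ Finset.range N,
        ((diffNet (dzCLM i))^[k] u).1 ε (x ε) * (w ^ k / k.factorial)‖ ≤
          C * (ε : ℝ) ^ (a + N * b) := by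
  induction N generalizing u with
  | zero =>
    obtain ⟨hn, δ, hδ, hδΩ, hO⟩ := hu
    obtain ⟨C, hC⟩ := derivO_zero_iff.1 hO
    refine ⟨C, ?_⟩
    filter_upwards [hC, hx (δ / 2) (half_pos hδ),
      (tendsto_rpow_toZero hb).eventually (eventually_le_nhds (half_pos hδ))] with ε h h1 h2 w hw
    simp only [Finset.range_zero, Finset.sum_empty, sub_zero, Nat.cast_zero, zero_mul, add_zero]
    exact h _ (closedBall_subset_cthickening_two hδ h1 (add_single_mem_closedBall i (hw.trans h2)))
  | succ N ih =>
    obtain ⟨C, hC⟩ := ih (hu.dz hK i)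
    obtain ⟨hn, δ, hδ, hδΩ, hO⟩ := hu
    -- The `∂̄`-derivative is null, so any exponent is available; this one matches the induction
    -- hypothesis.
    obtain ⟨C₁, hC₁⟩ := derivO_zero_iff.1 (hn i _ (hK.cthickening (r := δ)) hδΩ 0 (a + N * b))
    refine ⟨C + C₁, ?_⟩
    filter_upwards [hC, hC₁, hx (δ / 2) (half_pos hδ),
      (tendsto_rpow_toZero hb).eventually (eventually_le_nhds (half_pos hδ))] with ε h h' h1 h2 w hw
    have hmem : ∀ t ∈ Set.Icc (0 : ℝ) 1, ‖(t : ℂ) * w‖ ≤ (ε : ℝ) ^ b := fun t ht => by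
      rw [norm_mul, Complex.norm_real, Real.norm_of_nonneg ht.1]
      exact (mul_le_of_le_one_left (norm_nonneg w) ht.2).trans hw
    have hball : ∀ t ∈ Set.Icc (0 : ℝ) 1,
        x ε + Pi.single i ((t : ℂ) * w) ∈ Metric.cthickening δ K := fun t ht =>
      closedBall_subset_cthickening_two hδ h1 (add_single_mem_closedBall i ((hmem t ht).trans h2))
    have hd : ∀ t ∈ Set.Icc (0 : ℝ) 1, HasDerivWithinAt
        (fun t : ℝ => u.1 ε (x ε + Pi.single i ((t : ℂ) * w)) - ∑ k ∈ Finset.range (N + 1),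
          ((diffNet (dzCLM i))^[k] u).1 ε (x ε) * ((t * w) ^ k / k.factorial))
        (w * ((diffNet (dzCLM i) u).1 ε (x ε + Pi.single i ((t : ℂ) * w)) -
          ∑ k ∈ Finset.range N, ((diffNet (dzCLM i))^[k] (diffNet (dzCLM i) u)).1 ε (x ε) *
            ((t * w) ^ k / k.factorial)) +
          (starRingEnd ℂ) w * (diffNet (dbarCLM i) u).1 ε (x ε + Pi.single i ((t : ℂ) * w)))
        (Set.Icc 0 1) t := by
      intro t ht
      have e1 : HasDerivAt (fun t : ℝ => (t : ℂ) * w) w t := by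
        simpa using (Complex.ofRealCLM.hasDerivAt (x := t)).mul_const w
      refine (((hasDerivAt_line (u.2.1 ε) (x ε) i e1 (hδΩ (hball t ht))).sub
        (hasDerivAt_taylor_poly _ w N t)).congr_deriv ?_).hasDerivWithinAt
      simp only [Function.iterate_succ_apply, diffNet_apply]
      ring
    have hbd := norm_image_sub_le_of_norm_deriv_le_segment_01' hd
      (C := (C + C₁) * (ε : ℝ) ^ (a + (N + 1 : ℕ) * b)) fun t ht => by
        have ht' := Set.Ico_subset_Icc_self ht
        have g1 := h _ (hmem t ht')
        have g2 := h' _ (hball t ht')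
        have e2 : (ε : ℝ) ^ (a + (N + 1 : ℕ) * b) = (ε : ℝ) ^ b * (ε : ℝ) ^ (a + N * b) := by
          rw [← Real.rpow_add ε.2.1]
          congr 1
          push_cast
          ring
        refine (norm_add_le _ _).trans ?_
        rw [norm_mul, norm_mul, RCLike.norm_conj, e2]
        calc _ ≤ (ε : ℝ) ^ b * (C * (ε : ℝ) ^ (a + N * b)) +
              (ε : ℝ) ^ b * (C₁ * (ε : ℝ) ^ (a + N * b)) := by
              have e0 : 0 ≤ (ε : ℝ) ^ b := Real.rpow_nonneg ε.2.1.le b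
              gcongr
          _ = _ := by ring
    -- At `t = 0` only the term `k = 0` remains, so the remainder starts from zero.
    have hz : ∑ k ∈ Finset.range (N + 1), ((diffNet (dzCLM i))^[k] u).1 ε (x ε) *
        ((((0 : ℝ) : ℂ) * w) ^ k / k.factorial) = u.1 ε (x ε) := by
      rw [Finset.sum_range_succ']
      simp
    rw [hz] at hbd
    simpa using hbd

/-! ### Taylor's formula in several coordinates -/

/-- The iterated derivative `∂_z^n u` in the coordinates listed in `l`. -/
def dzMulti : List (Fin p) → (Fin p → ℕ) → ModFun Ω → ModFun Ω
  | [], _, u => u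
  | i :: l, n, u => dzMulti l n ((diffNet (dzCLM i))^[n i] u)

theorem HolO.dzMulti {K : Set (Fin p → ℂ)} (hK : IsCompact K) {a : ℝ} (l : List (Fin p))
    (n : Fin p → ℕ) {u : ModFun Ω} (hu : HolO K a u) : HolO K a (dzMulti l n u) := by
  induction l generalizing u with
  | nil => exact hu
  | cons i l ih => exact ih (hu.dz_iterate hK i (n i))

theorem dzMulti_update {l : List (Fin p)} {i : Fin p} (hi : i ∉ l) (n : Fin p → ℕ) (k : ℕ)
    (u : ModFun Ω) : dzMulti l (Function.update n i k) u = dzMulti l n u := by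
  induction l generalizing u with
  | nil => rfl
  | cons j l ih =>
    have hj : j ≠ i := fun h => hi (h ▸ List.mem_cons_self)
    simp only [Colombeau.dzMulti, Function.update_of_ne hj]
    exact ih (fun h => hi (List.mem_cons_of_mem j h)) _

/-- The multi-indices supported in `l` with entries below `N`. -/
def boxIndex (l : List (Fin p)) (N : ℕ) : Finset (Fin p → ℕ) :=
  Fintype.piFinset fun j => if j ∈ l then Finset.range N else {0}

theorem mem_boxIndex {l : List (Fin p)} {N : ℕ} {n : Fin p → ℕ} :
    n ∈ boxIndex l N ↔ ∀ j, (j ∈ l → n j < N) ∧ (j ∉ l → n j = 0) := by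
  simp only [boxIndex, Fintype.mem_piFinset]
  refine forall_congr' fun j => ?_
  by_cases hj : j ∈ l <;> simp [hj]

theorem sum_boxIndex_cons {l : List (Fin p)} {i : Fin p} (hi : i ∉ l) (N : ℕ)
    (F : (Fin p → ℕ) → ℂ) :
    ∑ n ∈ boxIndex (i :: l) N, F n =
      ∑ k ∈ Finset.range N, ∑ n ∈ boxIndex l N, F (Function.update n i k) := by
  rw [← Finset.sum_product']
  symm
  refine Finset.sum_bij' (fun q _ => Function.update q.2 i q.1)
    (fun n _ => (n i, Function.update n i 0)) ?_ ?_ ?_ ?_ ?_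
  · rintro ⟨k, n⟩ h
    rw [Finset.mem_product, Finset.mem_range, mem_boxIndex] at h
    refine mem_boxIndex.2 fun j => ?_
    rcases eq_or_ne j i with rfl | hj
    · simpa using h.1
    · simpa [hj] using h.2 j
  · intro n h
    rw [mem_boxIndex] at h
    rw [Finset.mem_product, Finset.mem_range, mem_boxIndex]
    refine ⟨(h i).1 List.mem_cons_self, fun j => ?_⟩
    rcases eq_or_ne j i with rfl | hj
    · simpa using fun h => absurd h hi
    · simpa [hj] using h j
  · rintro ⟨k, n⟩ h
    rw [Finset.mem_product, Finset.mem_range, mem_boxIndex] at h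
    have h0 : n i = 0 := (h.2 i).2 hi
    simp [← h0]
  · intro n _
    simp
  · intro q _
    rfl

theorem prod_update_monomial (h : Fin p → ℂ) {n : Fin p → ℕ} {i : Fin p} (hn : n i = 0) (k : ℕ) :
    ∏ j, h j ^ Function.update n i k j / ((Function.update n i k j).factorial : ℂ) =
      (∏ j, h j ^ n j / ((n j).factorial : ℂ)) * (h i ^ k / (k.factorial : ℂ)) := by
  rw [← Finset.mul_prod_erase _ _ (Finset.mem_univ i),
    ← Finset.mul_prod_erase _ (fun j => h j ^ n j / ((n j).factorial : ℂ)) (Finset.mem_univ i),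
    hn, Function.update_self, pow_zero, Nat.factorial_zero, Nat.cast_one, div_one, one_mul, mul_comm]
  congr 1
  refine Finset.prod_congr rfl fun j hj => ?_
  rw [Function.update_of_ne (Finset.ne_of_mem_erase hj)]

/-- The coordinates of `h` outside `l` are replaced by `0`. -/
def restrictCoords (l : List (Fin p)) (h : Fin p → ℂ) : Fin p → ℂ := fun j => if j ∈ l then h j else 0

theorem norm_restrictCoords_le (l : List (Fin p)) (h : Fin p → ℂ) : ‖restrictCoords l h‖ ≤ ‖h‖ := by
  refine (pi_norm_le_iff_of_nonneg (norm_nonneg h)).2 fun j => ?_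
  by_cases hj : j ∈ l
  · simpa [restrictCoords, hj] using norm_le_pi_norm h j
  · simp [restrictCoords, hj]

theorem restrictCoords_cons {l : List (Fin p)} {i : Fin p} (hi : i ∉ l) (h : Fin p → ℂ) :
    restrictCoords (i :: l) h = restrictCoords l h + Pi.single i (h i) := by
  funext j
  rcases eq_or_ne j i with rfl | hj
  · simp [restrictCoords, hi]
  · simp [restrictCoords, hj]

theorem NetO.of_eventually_le {E : Type*} [NormedAddCommGroup E] {u : Idx → E} {a C : ℝ}
    (h : ∀ᶠ ε : Idx in toZero, ‖u ε‖ ≤ C * (ε : ℝ) ^ a) : NetO u a := by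
  refine IsBigO.of_bound C (h.mono fun ε hε => ?_)
  rwa [Real.norm_of_nonneg (Real.rpow_nonneg ε.2.1.le _)]

theorem NetO.sum {ι : Type*} {s : Finset ι} {A : ι → Idx → ℂ} {a : ℝ}
    (h : ∀ i ∈ s, NetO (A i) a) : NetO (fun ε => ∑ i ∈ s, A i ε) a :=
  (IsBigO.sum h).congr_left fun ε => Finset.sum_apply ε s A

theorem HolO.netO_eval {K : Set (Fin p → ℂ)} {a : ℝ} {u : ModFun Ω} (hu : HolO K a u)
    {x : Idx → (Fin p → ℂ)} (hx : Near K x) : NetO (fun ε => u.1 ε (x ε)) a := by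
  obtain ⟨-, δ, hδ, -, hO⟩ := hu
  obtain ⟨C, hC⟩ := derivO_zero_iff.1 hO
  refine NetO.of_eventually_le (C := C) ?_
  filter_upwards [hC, hx δ hδ] with ε h1 h2
  exact h1 _ h2

theorem rpow_le_one {b : ℝ} (hb : 0 ≤ b) (ε : Idx) : (ε : ℝ) ^ b ≤ 1 :=
  Real.rpow_le_one ε.2.1.le ε.2.2.le hb

/-- Expand first in the direction `i` at the point displaced in the coordinates of `l`, then expand
each coefficient `∂_{z_i}^k u` in those coordinates by induction. Both are possible with the same
`a`: the displaced point stays near `K`, and `HolO` passes to the derivatives. -/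
theorem taylor_multi {K : Set (Fin p → ℂ)} (hK : IsCompact K) {a b : ℝ} (hb : 0 < b)
    {x : Idx → (Fin p → ℂ)} (hx : Near K x) {h : Idx → (Fin p → ℂ)}
    (hh : ∀ᶠ ε : Idx in toZero, ‖h ε‖ ≤ (ε : ℝ) ^ b) (N : ℕ) {l : List (Fin p)} (hl : l.Nodup)
    {u : ModFun Ω} (hu : HolO K a u) :
    NetO (fun ε => u.1 ε (x ε + restrictCoords l (h ε)) - ∑ n ∈ boxIndex l N,
      (dzMulti l n u).1 ε (x ε) * ∏ j, h ε j ^ n j / ((n j).factorial : ℂ)) (a + N * b) := by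
  induction l generalizing u with
  | nil =>
    have h0 : boxIndex ([] : List (Fin p)) N = {0} := by
      ext n
      simp [mem_boxIndex, funext_iff]
    have : restrictCoords ([] : List (Fin p)) = fun _ => 0 := by
      funext h j
      simp [restrictCoords]
    simp only [h0, this, Finset.sum_singleton, dzMulti, Pi.zero_apply, pow_zero, Nat.factorial_zero,
      Nat.cast_one, div_one, Finset.prod_const_one, mul_one, add_zero, sub_self]
    exact NetO.zero _
  | cons i l ih =>
    obtain ⟨hi, hl'⟩ := List.nodup_cons.1 hl
    have hy : Near K (x + fun ε => restrictCoords l (h ε)) := by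
      refine hx.add (NetO.tendsto_zero hb (NetO.of_eventually_le (C := 1) ?_))
      filter_upwards [hh] with ε hε
      rw [one_mul]
      exact (norm_restrictCoords_le l _).trans hε
    have hc : ∀ k : ℕ, NetO (fun ε => h ε i ^ k / (k.factorial : ℂ)) 0 := fun k => by
      refine NetO.of_eventually_le (C := 1) ?_
      filter_upwards [hh] with ε hε
      have h1 : ‖h ε i‖ ≤ 1 := (norm_le_pi_norm _ i).trans (hε.trans (rpow_le_one hb.le ε))
      rw [norm_div, norm_pow, Complex.norm_natCast, Real.rpow_zero, one_mul]
      refine div_le_one_of_le₀ ((pow_le_one₀ (norm_nonneg _) h1).trans ?_) (Nat.cast_nonneg _)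
      exact_mod_cast Nat.one_le_iff_ne_zero.2 k.factorial_ne_zero
    obtain ⟨C, hC⟩ := taylor_single hK hb hy i N hu
    have e1 : NetO (fun ε => u.1 ε (x ε + restrictCoords (i :: l) (h ε)) - ∑ k ∈ Finset.range N,
        ((diffNet (dzCLM i))^[k] u).1 ε (x ε + restrictCoords l (h ε)) *
          (h ε i ^ k / (k.factorial : ℂ))) (a + N * b) := by
      refine NetO.of_eventually_le (C := C) ?_
      filter_upwards [hC, hh] with ε h1 h2
      have := h1 (h ε i) ((norm_le_pi_norm _ i).trans h2)
      rw [restrictCoords_cons hi, ← add_assoc]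
      exact this
    have e2 : NetO (fun ε => ∑ k ∈ Finset.range N,
        (((diffNet (dzCLM i))^[k] u).1 ε (x ε + restrictCoords l (h ε)) - ∑ n ∈ boxIndex l N,
          (dzMulti l n ((diffNet (dzCLM i))^[k] u)).1 ε (x ε) *
            ∏ j, h ε j ^ n j / ((n j).factorial : ℂ)) *
          (h ε i ^ k / (k.factorial : ℂ))) (a + N * b) := by
      refine NetO.sum fun k _ => ?_
      have := (ih hl' (hu.dz_iterate hK i k)).mul (hc k)
      rwa [add_zero] at this
    refine (e1.add e2).congr_left fun ε => ?_
    rw [Pi.add_apply, sum_boxIndex_cons hi]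
    simp only [sub_mul, Finset.sum_sub_distrib]
    rw [sub_add_sub_cancel]
    congr 1
    refine Finset.sum_congr rfl fun k _ => ?_
    rw [Finset.sum_mul]
    refine Finset.sum_congr rfl fun n hn => ?_
    rw [prod_update_monomial _ ((mem_boxIndex.1 hn i).2 hi), mul_assoc]
    simp only [dzMulti, Function.update_self, dzMulti_update hi]

/-! ### Holomorphic generalized functions are S-holomorphic -/

/-- The constant of the `O`-estimate is absorbed by giving up part of the exponent. -/
theorem NetO.eventually_le {E : Type*} [NormedAddCommGroup E] {h : Idx → E} {b b' : ℝ}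
    (hb : b < b') (hh : NetO h b') : ∀ᶠ ε : Idx in toZero, ‖h ε‖ ≤ (ε : ℝ) ^ b := by
  obtain ⟨C, hC⟩ := hh.bound
  have h1 := (tendsto_rpow_toZero (sub_pos.2 hb)).const_mul C
  rw [mul_zero] at h1
  filter_upwards [hC, h1.eventually (eventually_le_nhds one_pos)] with ε h2 h3
  rw [Real.norm_of_nonneg (Real.rpow_nonneg ε.2.1.le _)] at h2
  refine h2.trans ?_
  have : (ε : ℝ) ^ b' = (ε : ℝ) ^ (b' - b) * (ε : ℝ) ^ b := by
    rw [← Real.rpow_add ε.2.1, sub_add_cancel]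
  rw [this, ← mul_assoc]
  exact mul_le_of_le_one_left (Real.rpow_nonneg ε.2.1.le _) h3

theorem PointNet.IsCompactlySupported.of_sub {x y : PointNet Ω} (hx : x.IsCompactlySupported)
    {b : ℝ} (hb : 0 < b) (h : NetO (y.1 - x.1) b) : y.IsCompactlySupported := by
  obtain ⟨K, hK, hKΩ, hxK⟩ := hx
  obtain ⟨δ, hδ, hδΩ⟩ := hK.exists_cthickening_subset_open Ω.isOpen hKΩ
  have := (Near.of_mem hxK).add (h.tendsto_zero hb) δ hδ
  rw [add_sub_cancel] at this
  exact ⟨_, hK.cthickening, hδΩ, this⟩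

theorem GenPoint.isCompactlySupported_mk {x : PointNet Ω} (hx : x.IsCompactlySupported) :
    (GenPoint.mk x).IsCompactlySupported := ⟨x, rfl, hx⟩

theorem GenPoint.dist_mk (x y : PointNet Ω) :
    dist (GenPoint.mk x) (GenPoint.mk y) = netNorm (x.1 - y.1) := rfl

theorem GenNum.dist_mk (u v : ModNum) :
    dist (GenNum.mk u) (GenNum.mk v) = netNorm ((u : Idx → ℂ) - (v : Idx → ℂ)) := rfl

/-- `GenNum.mk` as a ring homomorphism. -/
def GenNum.mkHom : ModNum →+* GenNum := Ideal.Quotient.mk NullNum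

theorem GenNum.mkHom_apply (u : ModNum) : GenNum.mkHom u = GenNum.mk u := rfl

/-- The net `∏ (y_i - x_i)^(n_i)`. -/
def PointNet.subPow (y x : PointNet Ω) (n : Fin p → ℕ) : ModNum :=
  ∏ i, (y.coord i - x.coord i) ^ n i

theorem GenPoint.subPow_mk (y x : PointNet Ω) (n : Fin p → ℕ) :
    (GenPoint.mk y).subPow (GenPoint.mk x) n = GenNum.mk (y.subPow x n) := by
  rw [← GenNum.mkHom_apply, PointNet.subPow, map_prod]
  simp only [map_pow, map_sub]
  rfl

theorem ModNum.prod_apply {ι : Type*} (F : Finset ι) (T : ι → ModNum) (ε : Idx) :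
    ((∏ n ∈ F, T n : ModNum) : Idx → ℂ) ε = ∏ n ∈ F, (T n : Idx → ℂ) ε :=
  map_prod ((Pi.evalRingHom (fun _ : Idx => ℂ) ε).comp ModNum.subtype) T F

theorem PointNet.subPow_apply (y x : PointNet Ω) (n : Fin p → ℕ) (ε : Idx) :
    (y.subPow x n : Idx → ℂ) ε = ∏ i, (y.1 ε i - x.1 ε i) ^ n i := by
  rw [PointNet.subPow, ModNum.prod_apply]
  rfl

theorem ModNum.sum_apply {ι : Type*} (F : Finset ι) (T : ι → ModNum) (ε : Idx) :
    ((∑ n ∈ F, T n : ModNum) : Idx → ℂ) ε = ∑ n ∈ F, (T n : Idx → ℂ) ε :=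
  map_sum ((Pi.evalRingHom (fun _ : Idx => ℂ) ε).comp ModNum.subtype) T F

/-- The ultrametric makes unconditional summability a matter of terms: adding finitely many terms of
order `a + N b` to the sum over `F₀` keeps the error at that order. -/
theorem hasSum_mk_of_forall_netO {ι : Type*} {T : ι → ModNum} {v : ModNum} {a b : ℝ} (hb : 0 < b)
    (h : ∀ N : ℕ, ∃ F₀ : Finset ι,
      NetO (fun ε => (v : Idx → ℂ) ε - ∑ n ∈ F₀, (T n : Idx → ℂ) ε) (a + N * b) ∧
        ∀ n ∉ F₀, NetO (T n : Idx → ℂ) (a + N * b)) :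
    HasSum (fun n => GenNum.mk (T n)) (GenNum.mk v) := by
  classical
  rw [HasSum, SummationFilter.unconditional_filter, Metric.tendsto_atTop]
  intro r hr
  -- Chosen so that `exp(-(a + N b)) < r`.
  obtain ⟨N, hN⟩ := exists_nat_gt ((-Real.log r - a) / b)
  obtain ⟨F₀, h1, h2⟩ := h N
  refine ⟨F₀, fun F hF => ?_⟩
  have e1 : ∑ n ∈ F, GenNum.mk (T n) = GenNum.mk (∑ n ∈ F, T n) :=
    (map_sum GenNum.mkHom T F).symm
  rw [e1, dist_comm, GenNum.dist_mk]
  have h3 : NetO ((v : Idx → ℂ) - ((∑ n ∈ F, T n : ModNum) : Idx → ℂ)) (a + N * b) := by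
    refine (h1.sub (NetO.sum (s := F \ F₀) fun n hn =>
      h2 n (Finset.mem_sdiff.1 hn).2)).congr_left fun ε => ?_
    simp only [Pi.sub_apply, ModNum.sum_apply]
    rw [← Finset.sum_sdiff hF]
    ring
  refine (netNorm_le h3).trans_lt ?_
  rw [← Real.exp_log hr, Real.exp_lt_exp]
  rw [div_lt_iff₀ hb] at hN
  linarith

theorem netO_subPow {y x : PointNet Ω} {b : ℝ} (hb : 0 < b)
    (hh : ∀ᶠ ε : Idx in toZero, ‖y.1 ε - x.1 ε‖ ≤ (ε : ℝ) ^ b) {n : Fin p → ℕ} {N : ℕ} {j : Fin p}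
    (hj : N ≤ n j) : NetO (y.subPow x n : Idx → ℂ) (N * b) := by
  refine NetO.of_eventually_le (C := 1) ?_
  filter_upwards [hh] with ε hε
  rw [PointNet.subPow_apply, norm_prod, one_mul, mul_comm, Real.rpow_mul_natCast ε.2.1.le]
  have e0 : 0 ≤ (ε : ℝ) ^ b := Real.rpow_nonneg ε.2.1.le b
  calc ∏ i, ‖(y.1 ε i - x.1 ε i) ^ n i‖ ≤ ∏ i, ((ε : ℝ) ^ b) ^ n i := by
        refine Finset.prod_le_prod (fun i _ => norm_nonneg _) fun i _ => ?_
        rw [norm_pow]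
        exact pow_le_pow_left₀ (norm_nonneg _) ((norm_le_pi_norm (y.1 ε - x.1 ε) i).trans hε) _
    _ = ((ε : ℝ) ^ b) ^ ∑ i, n i := Finset.prod_pow_eq_pow_sum _ _ _
    _ ≤ ((ε : ℝ) ^ b) ^ N := pow_le_pow_of_le_one e0 (rpow_le_one hb.le ε)
        (hj.trans (Finset.single_le_sum (fun i _ => Nat.zero_le (n i)) (Finset.mem_univ j)))

/-- The coefficients are the classes of `∂_z^n u(x)/n!`, all of one order `a`. In the sharp ball of
radius `exp(-1)` increments have order `1`, hence are eventually at most `ε^(1/2)`. -/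
theorem isSHolomorphic_of_dbarNull {u : ModFun Ω} (hu : DbarNull u) :
    (GenFun.mk u).IsSHolomorphic := by
  rintro _ ⟨x, rfl, hx⟩
  obtain ⟨K, hK, hKΩ, hxK⟩ := id hx
  have hnear := Near.of_mem hxK
  obtain ⟨δ, hδ, hδΩ⟩ := hK.exists_cthickening_subset_open Ω.isOpen hKΩ
  obtain ⟨a, ha⟩ := u.2.2 _ (hK.cthickening (r := δ)) hδΩ 0
  have hol : HolO K a u := ⟨hu, δ, hδ, hδΩ, ha⟩
  set l : List (Fin p) := List.finRange p with hl
  have hcoef : ∀ n : Fin p → ℕ, NetO (fun ε => (dzMulti l n u).1 ε (x.1 ε) *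
      ∏ j, ((n j).factorial : ℂ)⁻¹) a := fun n => by
    have h1 : NetO (fun _ : Idx => ∏ j, ((n j).factorial : ℂ)⁻¹) 0 :=
      NetO.of_eventually_le (C := ‖∏ j, ((n j).factorial : ℂ)⁻¹‖)
        (Eventually.of_forall fun ε => by rw [Real.rpow_zero, mul_one])
    have := ((hol.dzMulti hK l n).netO_eval hnear).mul h1
    rwa [add_zero] at this
  let coef : (Fin p → ℕ) → ModNum := fun n => ⟨_, a, hcoef n⟩
  have hball : ∀ y : PointNet Ω,
      GenPoint.mk y ∈ Metric.ball (GenPoint.mk x) (Real.exp (-1)) → NetO (y.1 - x.1) 1 := by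
    intro y hy
    rw [Metric.mem_ball, GenPoint.dist_mk] at hy
    obtain ⟨b, hb, hlt⟩ := netNorm_lt (y.moderate_sub x) hy
    exact hb.mono (by linarith [Real.exp_lt_exp.1 hlt])
  refine ⟨fun n => GenNum.mk (coef n), Metric.ball (GenPoint.mk x) (Real.exp (-1)),
    Metric.ball_mem_nhds _ (Real.exp_pos _), fun s hs => ?_, fun s hs => ?_⟩
  · obtain ⟨y, rfl⟩ := s.exists_rep
    exact GenPoint.isCompactlySupported_mk (hx.of_sub one_pos (hball y hs))
  · obtain ⟨y, rfl⟩ := s.exists_rep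
    have hyx := hball y hs
    have hy := hx.of_sub one_pos hyx
    have hh : ∀ᶠ ε : Idx in toZero, ‖y.1 ε - x.1 ε‖ ≤ (ε : ℝ) ^ (1 / 2 : ℝ) :=
      hyx.eventually_le (by norm_num)
    rw [GenFun.eval_eq u y hy]
    simp only [GenPoint.subPow_mk]
    refine hasSum_mk_of_forall_netO (T := fun n => coef n * y.subPow x n) (a := a) (b := 1 / 2)
      (by norm_num) fun N => ⟨boxIndex l N, ?_, fun n hn => ?_⟩
    · refine (taylor_multi hK (by norm_num) hnear hh N (List.nodup_finRange p) hol).congr_left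
        fun ε => ?_
      congr 1
      · have : restrictCoords (List.finRange p) (y.1 ε - x.1 ε) = y.1 ε - x.1 ε := by
          funext j
          simp [restrictCoords]
        rw [this, add_sub_cancel]
        rfl
      · refine Finset.sum_congr rfl fun n _ => ?_
        change _ = (dzMulti l n u).1 ε (x.1 ε) * (∏ j, ((n j).factorial : ℂ)⁻¹) *
          (y.subPow x n : Idx → ℂ) ε
        rw [PointNet.subPow_apply, mul_assoc, ← Finset.prod_mul_distrib]
        congr 1
        refine Finset.prod_congr rfl fun j _ => ?_
        rw [div_eq_mul_inv, mul_comm, Pi.sub_apply]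
    -- A multi-index outside the box has an entry at least `N`, which alone makes the monomial
    -- `O(ε^(N/2))`.
    · have : ∃ j, N ≤ n j := by
        by_contra! hcon
        exact hn (mem_boxIndex.2 fun j => ⟨fun _ => hcon j, fun h => absurd (List.mem_finRange j) h⟩)
      obtain ⟨j, hj⟩ := this
      exact (hcoef n).mul (netO_subPow (by norm_num) hh hj)

/-! ### Nets with null point values are null -/

section

variable {F : Type} [NormedAddCommGroup F] [NormedSpace ℝ F]

/-- The mean value inequality is used twice, first for the derivative and then for the function;
hence `B` instead of `B/2`. -/
theorem norm_taylor_two_le {G : (Fin p → ℂ) → F} (hG : ContDiffOn ℝ ∞ G Ω) {c : Fin p → ℂ} {R B : ℝ}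
    (hR : Metric.closedBall c R ⊆ Ω)
    (hB : ∀ z ∈ Metric.closedBall c R, ‖iteratedFDerivWithin ℝ 2 G Ω z‖ ≤ B) {h : Fin p → ℂ}
    (hh : ‖h‖ ≤ R) : ‖G (c + h) - G c - fderivWithin ℝ G Ω c h‖ ≤ B * ‖h‖ * ‖h‖ := by
  have hG' : ContDiffOn ℝ ∞ (fderivWithin ℝ G Ω) Ω :=
    hG.fderivWithin Ω.isOpen.uniqueDiffOn (by simp)
  have hsub : Metric.closedBall c ‖h‖ ⊆ Metric.closedBall c R := Metric.closedBall_subset_closedBall hh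
  have hc : c ∈ Metric.closedBall c ‖h‖ := Metric.mem_closedBall_self (norm_nonneg h)
  have h1 : ∀ z ∈ Metric.closedBall c ‖h‖,
      HasFDerivWithinAt G (fderivWithin ℝ G Ω z) (Metric.closedBall c ‖h‖) z := fun z hz =>
    ((hG.differentiableOn (by simp) z (hR (hsub hz))).hasFDerivWithinAt).mono (hsub.trans hR)
  have h2 : ∀ z ∈ Metric.closedBall c ‖h‖, HasFDerivWithinAt (fderivWithin ℝ G Ω)
      (fderivWithin ℝ (fderivWithin ℝ G Ω) Ω z) (Metric.closedBall c ‖h‖) z := fun z hz =>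
    ((hG'.differentiableOn (by simp) z (hR (hsub hz))).hasFDerivWithinAt).mono (hsub.trans hR)
  have hB' : ∀ z ∈ Metric.closedBall c ‖h‖, ‖fderivWithin ℝ (fderivWithin ℝ G Ω) Ω z‖ ≤ B := by
    intro z hz
    have hzΩ := hR (hsub hz)
    have := hB z (hsub hz)
    rwa [← norm_iteratedFDerivWithin_fderivWithin (n := 1) Ω.isOpen.uniqueDiffOn hzΩ,
      ← norm_iteratedFDerivWithin_fderivWithin (n := 0) Ω.isOpen.uniqueDiffOn hzΩ,
      norm_iteratedFDerivWithin_zero] at this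
  have hB0 : 0 ≤ B := (norm_nonneg _).trans (hB c (hsub hc))
  have hconv := convex_closedBall c ‖h‖
  have h3 : ∀ z ∈ Metric.closedBall c ‖h‖,
      ‖fderivWithin ℝ G Ω z - fderivWithin ℝ G Ω c‖ ≤ B * ‖h‖ := fun z hz =>
    (hconv.norm_image_sub_le_of_norm_hasFDerivWithin_le h2 hB' hc hz).trans
      (mul_le_mul_of_nonneg_left (mem_closedBall_iff_norm.1 hz) hB0)
  have := hconv.norm_image_sub_le_of_norm_hasFDerivWithin_le' h1 h3 hc
    (y := c + h) (by simp)
  rwa [add_sub_cancel_left] at this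

/-- Landau's inequality. -/
theorem norm_fderivWithin_le_of_landau {G : (Fin p → ℂ) → F} (hG : ContDiffOn ℝ ∞ G Ω)
    {c : Fin p → ℂ} {A B η : ℝ} (hη : 0 < η) (hR : Metric.closedBall c η ⊆ Ω)
    (hA : ∀ z ∈ Metric.closedBall c η, ‖G z‖ ≤ A)
    (hB : ∀ z ∈ Metric.closedBall c η, ‖iteratedFDerivWithin ℝ 2 G Ω z‖ ≤ B) :
    ‖fderivWithin ℝ G Ω c‖ ≤ 2 * A / η + B * η := by
  have hc : c ∈ Metric.closedBall c η := Metric.mem_closedBall_self hη.le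
  have hA0 : 0 ≤ A := (norm_nonneg _).trans (hA c hc)
  have hB0 : 0 ≤ B := (norm_nonneg _).trans (hB c hc)
  refine ContinuousLinearMap.opNorm_le_of_unit_norm (by positivity) fun v hv => ?_
  have hn : ‖η • v‖ = η := by rw [norm_smul, hv, mul_one, Real.norm_of_nonneg hη.le]
  have h1 := norm_taylor_two_le hG hR hB hn.le
  rw [hn, map_smul] at h1
  have h2 := hA (c + η • v) (by simp [hn])
  have h3 := hA c hc
  have h4 : η * ‖fderivWithin ℝ G Ω c v‖ ≤ 2 * A + B * η * η := by
    have e : η • fderivWithin ℝ G Ω c v =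
        (G (c + η • v) - G c) - (G (c + η • v) - G c - η • fderivWithin ℝ G Ω c v) := by abel
    have e' : η * ‖fderivWithin ℝ G Ω c v‖ = ‖η • fderivWithin ℝ G Ω c v‖ := by
      rw [norm_smul, Real.norm_of_nonneg hη.le]
    rw [e', e]
    refine (norm_sub_le _ _).trans ?_
    linarith [norm_sub_le (G (c + η • v)) (G c)]
  rw [div_add' _ _ _ hη.ne', le_div_iff₀ hη]
  linarith

end

/-- Landau's inequality bounds the first derivative by the null values and the moderate second
derivative. Induction replaces `G` by its derivative, which is why the target space `F` varies. -/
theorem null_derivatives_of_null (n : ℕ) {F : Type} [NormedAddCommGroup F] [NormedSpace ℝ F]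
    {G : Idx → (Fin p → ℂ) → F} (hG : ∀ ε, ContDiffOn ℝ ∞ (G ε) Ω)
    (hmod : ∀ K : Set (Fin p → ℂ), IsCompact K → K ⊆ Ω → ∀ n : ℕ, ∃ a C : ℝ,
      ∀ᶠ ε : Idx in toZero, ∀ x ∈ K, ‖iteratedFDerivWithin ℝ n (G ε) Ω x‖ ≤ C * (ε : ℝ) ^ a)
    (hnull : ∀ K : Set (Fin p → ℂ), IsCompact K → K ⊆ Ω → ∀ b : ℝ, ∃ C : ℝ,
      ∀ᶠ ε : Idx in toZero, ∀ x ∈ K, ‖G ε x‖ ≤ C * (ε : ℝ) ^ b)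
    {K : Set (Fin p → ℂ)} (hK : IsCompact K) (hKΩ : K ⊆ Ω) (b : ℝ) :
    ∃ C : ℝ, ∀ᶠ ε : Idx in toZero, ∀ x ∈ K,
      ‖iteratedFDerivWithin ℝ n (G ε) Ω x‖ ≤ C * (ε : ℝ) ^ b := by
  induction n generalizing F with
  | zero => simpa only [norm_iteratedFDerivWithin_zero] using hnull K hK hKΩ b
  | succ n ih =>
    have := ih (G := fun ε => fderivWithin ℝ (G ε) Ω)
      (fun ε => (hG ε).fderivWithin Ω.isOpen.uniqueDiffOn (by simp)) ?_ ?_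
    · obtain ⟨C, hC⟩ := this
      refine ⟨C, hC.mono fun ε h x hx => ?_⟩
      rw [← norm_iteratedFDerivWithin_fderivWithin Ω.isOpen.uniqueDiffOn (hKΩ hx)]
      exact h x hx
    · intro K hK hKΩ m
      obtain ⟨a, C, hC⟩ := hmod K hK hKΩ (m + 1)
      refine ⟨a, C, hC.mono fun ε h x hx => ?_⟩
      rw [norm_iteratedFDerivWithin_fderivWithin Ω.isOpen.uniqueDiffOn (hKΩ hx)]
      exact h x hx
    · intro K hK hKΩ b
      obtain ⟨δ, hδ, hδΩ⟩ := hK.exists_cthickening_subset_open Ω.isOpen hKΩ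
      obtain ⟨a, B, hB⟩ := hmod _ (hK.cthickening (r := δ)) hδΩ 2
      -- With step `ε^m`, `m ≥ b - a` brings the second-derivative term to order `b`, and `m ≥ 1`
      -- makes the step tend to zero. The exponent `b + m` for `G` pays for the division by `ε^m`.
      set m : ℝ := max (b - a) 1 with hm
      have hm0 : 0 < m := lt_max_of_lt_right one_pos
      obtain ⟨A, hA⟩ := hnull _ (hK.cthickening (r := δ)) hδΩ (b + m)
      refine ⟨2 * A + |B|, ?_⟩
      filter_upwards [hA, hB, (tendsto_rpow_toZero hm0).eventually (eventually_le_nhds hδ)]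
        with ε h1 h2 h3 x hx
      have hη : 0 < (ε : ℝ) ^ m := Real.rpow_pos_of_pos ε.2.1 m
      have hball : Metric.closedBall x ((ε : ℝ) ^ m) ⊆ Metric.cthickening δ K :=
        (Metric.closedBall_subset_closedBall h3).trans (Metric.closedBall_subset_cthickening hx δ)
      refine (norm_fderivWithin_le_of_landau (hG ε) hη (hball.trans hδΩ)
        (fun z hz => h1 z (hball hz)) (fun z hz => h2 z (hball hz))).trans ?_
      have e1 : 2 * (A * (ε : ℝ) ^ (b + m)) / (ε : ℝ) ^ m = 2 * A * (ε : ℝ) ^ b := by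
        rw [Real.rpow_add ε.2.1]
        field_simp
      have e2 : B * (ε : ℝ) ^ a * (ε : ℝ) ^ m ≤ |B| * (ε : ℝ) ^ b := by
        rw [mul_assoc, ← Real.rpow_add ε.2.1]
        refine mul_le_mul (le_abs_self B) (rpow_anti ε ?_) (Real.rpow_nonneg ε.2.1.le _)
          (abs_nonneg B)
        linarith [le_max_left (b - a) 1]
      rw [e1, add_mul]
      linarith

theorem one_le_rpow_neg_one (ε : Idx) : 1 ≤ (ε : ℝ) ^ (-1 : ℝ) := by
  have := rpow_anti ε (show (-1 : ℝ) ≤ 0 by norm_num)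
  rwa [Real.rpow_zero] at this

/-- For each `ε` choose a point of `K` where `|v_ε|` is maximal. These points form a compactly
supported net, at which nullity bounds the supremum over `K`. -/
theorem mem_nullFun_of_eval {v : ModFun Ω} (h : ∀ x : PointNet Ω, x.IsCompactlySupported →
    ∀ b, NetO (fun ε => v.1 ε (x.1 ε)) b) : v ∈ NullFun Ω := by
  intro K hK hKΩ n b
  refine null_derivatives_of_null n v.2.1 v.2.2 (fun K hK hKΩ b => ?_) hK hKΩ b
  rcases K.eq_empty_or_nonempty with rfl | hne
  · exact ⟨0, Eventually.of_forall fun ε x hx => absurd hx (Set.notMem_empty x)⟩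
  have hmax : ∀ ε, ∃ x ∈ K, ∀ y ∈ K, ‖v.1 ε y‖ ≤ ‖v.1 ε x‖ := fun ε =>
    hK.exists_isMaxOn hne ((v.2.1 ε).continuousOn.mono hKΩ).norm
  choose x hxK hx using hmax
  obtain ⟨M, hM⟩ := hK.isBounded.exists_norm_le
  -- The net is bounded, but `PointNet` asks for `O(ε^(-a))` with `a > 0`; `a = 1` serves.
  have hmod : NetO x (-1) := by
    refine NetO.of_eventually_le (C := M) (Eventually.of_forall fun ε => ?_)
    have h0 := hM _ (hxK ε)
    exact h0.trans (le_mul_of_one_le_right ((norm_nonneg _).trans h0) (one_le_rpow_neg_one ε))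
  obtain ⟨C, hC⟩ := (h ⟨x, fun ε => hKΩ (hxK ε), 1, one_pos, hmod⟩
    ⟨K, hK, hKΩ, Eventually.of_forall hxK⟩ b).bound
  refine ⟨C, hC.mono fun ε hε y hy => (hx ε y hy).trans ?_⟩
  rwa [Real.norm_of_nonneg (Real.rpow_nonneg ε.2.1.le _)] at hε

/-! ### Convergent series of generalized numbers -/

theorem netO_of_hasSum_mk {ι : Type*} {T : ι → ModNum} {v : ModNum}
    (hs : HasSum (fun n => GenNum.mk (T n)) (GenNum.mk v)) (c : ℝ) :
    ∃ F₀ : Finset ι, ∀ F : Finset ι, F₀ ⊆ F →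
      NetO (fun ε => ∑ n ∈ F, (T n : Idx → ℂ) ε - (v : Idx → ℂ) ε) c := by
  classical
  rw [HasSum, SummationFilter.unconditional_filter, Metric.tendsto_atTop] at hs
  obtain ⟨F₀, hF₀⟩ := hs (Real.exp (-c)) (Real.exp_pos _)
  refine ⟨F₀, fun F hF => ?_⟩
  have e1 : ∑ n ∈ F, GenNum.mk (T n) = GenNum.mk (∑ n ∈ F, T n) :=
    (map_sum GenNum.mkHom T F).symm
  have h := hF₀ F hF
  rw [e1, GenNum.dist_mk] at h
  obtain ⟨b, hb, hlt⟩ := netNorm_lt (∑ n ∈ F, T n - v).2 h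
  refine (hb.mono (by linarith [Real.exp_lt_exp.1 hlt])).congr_left fun ε => ?_
  rw [← ModNum.sum_apply]
  rfl

/-- Outside a finite set, each term is the difference of two partial sums that both agree with the
limit to order `0`; the remaining finitely many terms have a common order. -/
theorem exists_netO_of_hasSum_mk {ι : Type*} {T : ι → ModNum} {v : ModNum}
    (hs : HasSum (fun n => GenNum.mk (T n)) (GenNum.mk v)) :
    ∃ c, ∀ n, NetO (T n : Idx → ℂ) c := by
  classical
  obtain ⟨F₀, hF₀⟩ := netO_of_hasSum_mk hs 0
  choose a ha using fun n => (T n).2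
  obtain ⟨c, hc⟩ := (F₀.image a).bddBelow
  refine ⟨min c 0, fun n => ?_⟩
  by_cases hn : n ∈ F₀
  · exact (ha n).mono ((min_le_left c 0).trans (hc (Finset.mem_coe.2 (Finset.mem_image_of_mem a hn))))
  · refine NetO.mono (b := 0) ?_ (min_le_right c 0)
    refine ((hF₀ (insert n F₀) (Finset.subset_insert n F₀)).sub (hF₀ F₀ subset_rfl)).congr_left
      fun ε => ?_
    simp only [Pi.sub_apply]
    rw [Finset.sum_insert hn]
    ring

/-- By the ultrametric inequality, a tail whose terms all have order `c` has order `c`. The index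
set is enlarged to contain both `F` and a set whose partial sum is accurate to order `c`. -/
theorem netO_sub_sum_of_hasSum_mk {ι : Type*} {T : ι → ModNum} {v : ModNum}
    (hs : HasSum (fun n => GenNum.mk (T n)) (GenNum.mk v)) {F : Finset ι} {c : ℝ}
    (h : ∀ n ∉ F, NetO (T n : Idx → ℂ) c) :
    NetO (fun ε => (v : Idx → ℂ) ε - ∑ n ∈ F, (T n : Idx → ℂ) ε) c := by
  classical
  obtain ⟨F₀, hF₀⟩ := netO_of_hasSum_mk hs c
  refine ((NetO.sum (s := (F₀ ∪ F) \ F) fun n hn => h n (Finset.mem_sdiff.1 hn).2).sub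
    (hF₀ (F₀ ∪ F) Finset.subset_union_left)).congr_left fun ε => ?_
  simp only [Pi.sub_apply]
  rw [← Finset.sum_sdiff (Finset.subset_union_right : F ⊆ F₀ ∪ F)]
  ring

/-! ### S-holomorphic generalized functions are holomorphic -/

open Classical in
/-- The net `x_ε + τ ε^m e_i`, with `x_ε` in place of points outside `Ω`. -/
def shiftNet (x : PointNet Ω) (i : Fin p) (τ : ℂ) (m : ℝ) : PointNet Ω :=
  ⟨fun ε => if x.1 ε + Pi.single i (τ * ((ε : ℝ) ^ m : ℝ)) ∈ Ω
      then x.1 ε + Pi.single i (τ * ((ε : ℝ) ^ m : ℝ)) else x.1 ε, fun ε => by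
    dsimp only
    split_ifs with h
    · exact h
    · exact x.2.1 ε, by
    obtain ⟨a, ha0, ha⟩ := x.2.2
    refine ⟨max a (-m), lt_max_of_lt_left ha0, ?_⟩
    have h : NetO (fun ε : Idx => (if x.1 ε + Pi.single i (τ * ((ε : ℝ) ^ m : ℝ)) ∈ Ω
      then x.1 ε + Pi.single i (τ * ((ε : ℝ) ^ m : ℝ)) else x.1 ε) - x.1 ε) m := by
      refine NetO.of_eventually_le (C := ‖τ‖) (Eventually.of_forall fun ε => ?_)
      have e0 : 0 ≤ (ε : ℝ) ^ m := Real.rpow_nonneg ε.2.1.le m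
      split_ifs with h
      · rw [add_sub_cancel_left, Pi.norm_single, norm_mul, Complex.norm_real,
          Real.norm_of_nonneg e0]
      · rw [sub_self, norm_zero]
        positivity
    have h1 := (ha.mono (neg_le_neg (le_max_left a (-m)))).add
      (h.mono (show -max a (-m) ≤ m by linarith [le_max_right a (-m)]))
    refine h1.congr_left fun ε => ?_
    simp⟩

theorem shiftNet_sub_netO (x : PointNet Ω) (i : Fin p) (τ : ℂ) (m : ℝ) :
    NetO ((shiftNet x i τ m).1 - x.1) m := by
  refine NetO.of_eventually_le (C := ‖τ‖) (Eventually.of_forall fun ε => ?_)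
  have e0 : 0 ≤ (ε : ℝ) ^ m := Real.rpow_nonneg ε.2.1.le m
  simp only [Pi.sub_apply, shiftNet]
  split_ifs with h
  · rw [add_sub_cancel_left, Pi.norm_single, norm_mul, Complex.norm_real,
      Real.norm_of_nonneg e0]
  · rw [sub_self, norm_zero]
    positivity

theorem norm_mul_rpow {τ : ℂ} (hτ : ‖τ‖ = 1) (ε : Idx) (m : ℝ) :
    ‖τ * ((ε : ℝ) ^ m : ℝ)‖ = (ε : ℝ) ^ m := by
  rw [norm_mul, hτ, one_mul, Complex.norm_real,
    Real.norm_of_nonneg (Real.rpow_nonneg ε.2.1.le m)]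

/-- For small `ε` the shifted point lies in a thickening of `K` inside `Ω`, so the fallback value
plays no role asymptotically. -/
theorem shiftNet_eventually {x : PointNet Ω} (hx : x.IsCompactlySupported) (i : Fin p) {τ : ℂ}
    (hτ : ‖τ‖ = 1) {m : ℝ} (hm : 0 < m) : ∀ᶠ ε : Idx in toZero,
      (shiftNet x i τ m).1 ε = x.1 ε + Pi.single i (τ * ((ε : ℝ) ^ m : ℝ)) := by
  obtain ⟨K, hK, hKΩ, hxK⟩ := hx
  obtain ⟨δ, hδ, hδΩ⟩ := hK.exists_cthickening_subset_open Ω.isOpen hKΩ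
  filter_upwards [hxK, (tendsto_rpow_toZero hm).eventually (eventually_le_nhds hδ)] with ε h1 h2
  refine if_pos (hδΩ (Metric.closedBall_subset_cthickening h1 δ ?_))
  exact add_single_mem_closedBall i ((norm_mul_rpow hτ ε m).trans_le h2)

/-- The exponent `a` is that of the second derivatives on a fixed thickening of `K`, so one choice
serves all `m` and `τ`. -/
theorem taylor_shift {u : ModFun Ω} {x : PointNet Ω} (hx : x.IsCompactlySupported) (i : Fin p) :
    ∃ a : ℝ, ∀ m > 0, ∀ τ : ℂ, ‖τ‖ = 1 →
      NetO (fun ε : Idx => u.1 ε ((shiftNet x i τ m).1 ε) - u.1 ε (x.1 ε) -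
        ((diffNet (dzCLM i) u).1 ε (x.1 ε) * (τ * ((ε : ℝ) ^ m : ℝ)) +
          (diffNet (dbarCLM i) u).1 ε (x.1 ε) * (starRingEnd ℂ) (τ * ((ε : ℝ) ^ m : ℝ))))
        (a + 2 * m) := by
  obtain ⟨K, hK, hKΩ, hxK⟩ := id hx
  obtain ⟨δ, hδ, hδΩ⟩ := hK.exists_cthickening_subset_open Ω.isOpen hKΩ
  obtain ⟨a, B, hB⟩ := u.2.2 _ (hK.cthickening (r := δ)) hδΩ 2
  refine ⟨a, fun m hm τ hτ => NetO.of_eventually_le (C := B) ?_⟩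
  filter_upwards [hB, hxK, shiftNet_eventually hx i hτ hm,
    (tendsto_rpow_toZero hm).eventually (eventually_le_nhds hδ)] with ε h1 h2 h3 h4
  have hball := Metric.closedBall_subset_cthickening h2 δ
  have hn : ‖(Pi.single i (τ * ((ε : ℝ) ^ m : ℝ)) : Fin p → ℂ)‖ = (ε : ℝ) ^ m := by
    rw [Pi.norm_single, norm_mul_rpow hτ]
  have := norm_taylor_two_le (u.2.1 ε) (hball.trans hδΩ) (fun z hz => h1 z (hball hz))
    (hn.trans_le h4)
  rw [hn, apply_single_eq] at this
  rw [h3]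
  refine this.trans_eq ?_
  rw [Real.rpow_add ε.2.1, two_mul, Real.rpow_add ε.2.1]
  ring

theorem prod_single_pow (i : Fin p) (w : ℂ) {n : Fin p → ℕ} (h : ∃ j ≠ i, n j ≠ 0) :
    ∏ j, (Pi.single i w : Fin p → ℂ) j ^ n j = 0 := by
  obtain ⟨j, hj, hn⟩ := h
  exact Finset.prod_eq_zero (Finset.mem_univ j) (by simp [hj, hn])

/-- Homogeneity of monomials, which transfers bounds on the series terms from the scale `ε^(m₀)` to
`ε^m`. -/
theorem norm_prod_single_pow (i : Fin p) (w : ℂ) (s : ℂ) (n : Fin p → ℕ) :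
    ‖∏ j, (Pi.single i (w * s) : Fin p → ℂ) j ^ n j‖ =
      ‖∏ j, (Pi.single i w : Fin p → ℂ) j ^ n j‖ * ‖s‖ ^ ∑ j, n j := by
  rw [norm_prod, norm_prod, ← Finset.prod_pow_eq_pow_sum, ← Finset.prod_mul_distrib]
  refine Finset.prod_congr rfl fun j _ => ?_
  rcases eq_or_ne j i with rfl | hj
  · simp only [Pi.single_eq_same, norm_pow, norm_mul, mul_pow]
  · rcases Nat.eq_zero_or_pos (n j) with h0 | h0
    · simp [h0]
    · simp [hj, h0.ne']

theorem two_le_sum {i : Fin p} {n : Fin p → ℕ} (h : ∀ j ≠ i, n j = 0) (h0 : n ≠ 0)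
    (h1 : n ≠ Pi.single i 1) : 2 ≤ ∑ j, n j := by
  have hn : n = Pi.single i (n i) := by
    funext j
    rcases eq_or_ne j i with rfl | hj
    · simp
    · simp [hj, h j hj]
  have : n i ≤ ∑ j, n j := Finset.single_le_sum (fun i _ => Nat.zero_le (n i)) (Finset.mem_univ i)
  by_contra! hlt
  have h3 : n i = 0 ∨ n i = 1 := by omega
  rcases h3 with h3 | h3
  · exact h0 (by rw [hn, h3, Pi.single_zero])
  · exact h1 (by rw [hn, h3])

theorem subPow_shift_eventually {x : PointNet Ω} (hx : x.IsCompactlySupported) (i : Fin p) {τ : ℂ}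
    (hτ : ‖τ‖ = 1) {m : ℝ} (hm : 0 < m) : ∀ᶠ ε : Idx in toZero, ∀ n : Fin p → ℕ,
      ((shiftNet x i τ m).subPow x n : Idx → ℂ) ε =
        ∏ j, (Pi.single i (τ * ((ε : ℝ) ^ m : ℝ)) : Fin p → ℂ) j ^ n j := by
  filter_upwards [shiftNet_eventually hx i hτ hm] with ε h n
  rw [PointNet.subPow_apply, h]
  refine Finset.prod_congr rfl fun j _ => ?_
  rw [Pi.add_apply, add_sub_cancel_left]

/-- Convergence at the single scale `m₀` gives all terms a common order `c`. Passing to `m ≥ m₀`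
multiplies a term of degree at least `2` by at most `ε^(2(m - m₀))` in modulus, so everything beyond
degree one is `O(ε^(c - 2m₀ + 2m))`. -/
theorem expansion_shift {u : ModFun Ω} {x : PointNet Ω} (hx : x.IsCompactlySupported)
    (hu : (GenFun.mk u).IsSHolomorphicAt (GenPoint.mk x)) (i : Fin p) :
    ∃ (A₀ A₁ : Idx → ℂ) (c m₀ : ℝ), ∀ m ≥ m₀, ∀ τ : ℂ, ‖τ‖ = 1 →
      NetO (fun ε : Idx => u.1 ε ((shiftNet x i τ m).1 ε) -
        (A₀ ε + A₁ ε * (τ * ((ε : ℝ) ^ m : ℝ)))) (c + 2 * m) := by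
  obtain ⟨a, W, hW, hWc, hsum⟩ := hu
  choose A hA using fun n => (a n).exists_rep
  obtain ⟨η, hη, hηW⟩ := Metric.mem_nhds_iff.1 hW
  -- For `m ≥ m₀` one has `exp(-m) < η`, so the shifted points lie in `W`; the `1` keeps `m`
  -- positive.
  set m₀ : ℝ := max 1 (1 - Real.log η) with hm₀
  have hpos : ∀ m ≥ m₀, 0 < m := fun m hm => lt_of_lt_of_le one_pos ((le_max_left _ _).trans hm)
  have hmem : ∀ m ≥ m₀, ∀ τ : ℂ, GenPoint.mk (shiftNet x i τ m) ∈ W := by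
    intro m hm τ
    refine hηW ?_
    rw [Metric.mem_ball, GenPoint.dist_mk]
    refine (netNorm_le (shiftNet_sub_netO x i τ m)).trans_lt ?_
    rw [← Real.exp_log hη, Real.exp_lt_exp]
    linarith [(le_max_right 1 (1 - Real.log η)).trans hm]
  have hs : ∀ m ≥ m₀, ∀ τ : ℂ, ∃ hy : (shiftNet x i τ m).IsCompactlySupported,
      HasSum (fun n => GenNum.mk (A n * (shiftNet x i τ m).subPow x n))
        (GenNum.mk (evalNet u (shiftNet x i τ m) hy)) := by
    intro m hm τ
    have hy := hx.of_sub (hpos m hm) (shiftNet_sub_netO x i τ m)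
    refine ⟨hy, ?_⟩
    have := hsum _ (hmem m hm τ)
    rw [GenFun.eval_eq u _ hy] at this
    convert this using 2 with n
    rw [GenPoint.subPow_mk, ← hA n]
    rfl
  obtain ⟨hy₀, hs₀⟩ := hs m₀ le_rfl 1
  obtain ⟨c, hc⟩ := exists_netO_of_hasSum_mk hs₀
  refine ⟨A 0, A (Pi.single i 1), c - 2 * m₀, m₀, fun m hm τ hτ => ?_⟩
  obtain ⟨hy, hsm⟩ := hs m hm τ
  have key : ∀ n ∉ ({0, Pi.single i 1} : Finset (Fin p → ℕ)),
      NetO ((A n * (shiftNet x i τ m).subPow x n : ModNum) : Idx → ℂ) (c - 2 * m₀ + 2 * m) := by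
    intro n hn
    simp only [Finset.mem_insert, Finset.mem_singleton, not_or] at hn
    -- The increment has only an `i`-th coordinate, so monomials involving another coordinate vanish
    -- for small `ε`.
    by_cases h : ∃ j ≠ i, n j ≠ 0
    · refine NetO.of_eventually_le (C := 0) ?_
      filter_upwards [subPow_shift_eventually hx i hτ (hpos m hm)] with ε hε
      change ‖(A n : Idx → ℂ) ε * ((shiftNet x i τ m).subPow x n : Idx → ℂ) ε‖ ≤ _
      rw [hε n, prod_single_pow i _ h]
      simp
    · push Not at h
      have h2 := two_le_sum h hn.1 hn.2
      obtain ⟨C, hC⟩ := (hc n).bound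
      refine NetO.of_eventually_le (C := C) ?_
      filter_upwards [hC, subPow_shift_eventually hx i hτ (hpos m hm),
        subPow_shift_eventually hx i norm_one (hpos m₀ le_rfl)] with ε h3 h4 h5
      rw [Real.norm_of_nonneg (Real.rpow_nonneg ε.2.1.le _)] at h3
      change ‖(A n : Idx → ℂ) ε * ((shiftNet x i 1 m₀).subPow x n : Idx → ℂ) ε‖ ≤ _ at h3
      change ‖(A n : Idx → ℂ) ε * ((shiftNet x i τ m).subPow x n : Idx → ℂ) ε‖ ≤ _
      rw [h5 n] at h3
      have e : τ * (((ε : ℝ) ^ m : ℝ) : ℂ) =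
          (1 * (((ε : ℝ) ^ m₀ : ℝ) : ℂ)) * (τ * (((ε : ℝ) ^ (m - m₀) : ℝ) : ℂ)) := by
        rw [show m = m₀ + (m - m₀) by ring, Real.rpow_add ε.2.1]
        push_cast
        rw [add_sub_cancel_left]
        ring
      rw [h4 n, e, norm_mul, norm_prod_single_pow, ← mul_assoc, ← norm_mul, norm_mul_rpow hτ]
      have e2 : (ε : ℝ) ^ (c - 2 * m₀ + 2 * m) = (ε : ℝ) ^ c * ((ε : ℝ) ^ (m - m₀)) ^ 2 := by
        rw [← Real.rpow_mul_natCast ε.2.1.le, ← Real.rpow_add ε.2.1]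
        congr 1
        push_cast
        ring
      rw [e2, ← mul_assoc]
      exact mul_le_mul h3 (pow_le_pow_of_le_one (Real.rpow_nonneg ε.2.1.le _)
        (rpow_le_one (sub_nonneg.2 hm) ε) h2) (pow_nonneg (Real.rpow_nonneg ε.2.1.le _) _)
        ((norm_nonneg _).trans h3)
  refine (netO_sub_sum_of_hasSum_mk hsm key).congr' ?_ EventuallyEq.rfl
  filter_upwards [subPow_shift_eventually hx i hτ (hpos m hm)] with ε hε
  have hne : (0 : Fin p → ℕ) ≠ Pi.single i 1 := fun h => by simpa using congrFun h i
  rw [Finset.sum_pair hne]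
  change _ - ((A 0 : Idx → ℂ) ε * ((shiftNet x i τ m).subPow x 0 : Idx → ℂ) ε +
    (A (Pi.single i 1) : Idx → ℂ) ε *
      ((shiftNet x i τ m).subPow x (Pi.single i 1) : Idx → ℂ) ε) = _
  rw [hε, hε]
  have e1 : ∏ j, (Pi.single i (τ * (((ε : ℝ) ^ m : ℝ) : ℂ)) : Fin p → ℂ) j ^
      (Pi.single i 1 : Fin p → ℕ) j = τ * (((ε : ℝ) ^ m : ℝ) : ℂ) := by
    rw [Finset.prod_eq_single i (fun j _ hj => by simp [hj]) (by simp)]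
    simp
  rw [e1]
  simp [evalNet]

/-- Only the antilinear term distinguishes the real Taylor formula from the power series to first
order; a discrete Fourier average over four directions isolates it. -/
theorem dbarNull_of_isSHolomorphic {u : ModFun Ω} (hu : (GenFun.mk u).IsSHolomorphic) :
    DbarNull u := by
  intro i
  refine mem_nullFun_of_eval fun x hx b => ?_
  obtain ⟨A₀, A₁, c, m₀, hE⟩ :=
    expansion_shift hx (hu _ (GenPoint.isCompactlySupported_mk hx)) i
  obtain ⟨a, hT⟩ := taylor_shift (u := u) hx i
  -- After division by `ε^m` the error has order `min a c + m`, which must be at least `b`.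
  set m : ℝ := max (max m₀ 1) (b - min a c) with hm
  have hm1 : m₀ ≤ m := (le_max_left _ _).trans (le_max_left _ _)
  have hm2 : 0 < m := lt_of_lt_of_le one_pos ((le_max_right _ _).trans (le_max_left _ _))
  have hm3 : b ≤ min a c + m := by linarith [le_max_right (max m₀ 1) (b - min a c)]
  have hD : ∀ τ : ℂ, ‖τ‖ = 1 → NetO (fun ε : Idx => τ * (u.1 ε (x.1 ε) - A₀ ε +
      ((diffNet (dzCLM i) u).1 ε (x.1 ε) - A₁ ε) * (τ * ((ε : ℝ) ^ m : ℝ)) +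
      (diffNet (dbarCLM i) u).1 ε (x.1 ε) * (starRingEnd ℂ) (τ * ((ε : ℝ) ^ m : ℝ))))
        (min a c + 2 * m) := by
    intro τ hτ
    have h1 := ((hE m hm1 τ hτ).mono (show min a c + 2 * m ≤ _ by gcongr; exact min_le_right a c)).sub
      ((hT m hm2 τ hτ).mono (show min a c + 2 * m ≤ _ by gcongr; exact min_le_left a c))
    refine (IsBigO.const_mul_left h1 τ).congr_left fun ε => ?_
    simp only [Pi.sub_apply]
    ring
  have hI := Complex.norm_I
  -- Over the fourth roots of unity `∑ τ = ∑ τ² = 0` and `∑ τ τ̄ = 4`, so only the `∂̄`-term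
  -- survives.
  have hsum := ((hD 1 norm_one).add (hD (-1) (by simp))).add
    ((hD Complex.I hI).add (hD (-Complex.I) (by simp)))
  obtain ⟨C, hC⟩ := hsum.bound
  refine NetO.of_eventually_le (C := |C|) ?_
  filter_upwards [hC] with ε h
  rw [Real.norm_of_nonneg (Real.rpow_nonneg ε.2.1.le _)] at h
  have hpos : 0 < (ε : ℝ) ^ m := Real.rpow_pos_of_pos ε.2.1 m
  set R := (diffNet (dbarCLM i) u).1 ε (x.1 ε) with hR
  have e : ‖(4 : ℂ) * (R * (((ε : ℝ) ^ m : ℝ) : ℂ))‖ ≤ C * (ε : ℝ) ^ (min a c + 2 * m) := by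
    refine (congrArg norm ?_).trans_le h
    simp only [Pi.add_apply, map_mul, map_neg, map_one, Complex.conj_I, Complex.conj_ofReal, ← hR]
    linear_combination (2 * R - 2 * ((diffNet (dzCLM i) u).1 ε (x.1 ε) - A₁ ε)) * (((ε : ℝ) ^ m : ℝ) : ℂ) * Complex.I_sq
  rw [norm_mul, norm_mul, Complex.norm_ofNat, Complex.norm_real, Real.norm_of_nonneg hpos.le,
    show min a c + 2 * m = (min a c + m) + m by ring, Real.rpow_add ε.2.1, ← mul_assoc,
    ← mul_assoc] at e
  have e1 := le_of_mul_le_mul_right e hpos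
  have e2 : C * (ε : ℝ) ^ (min a c + m) ≤ |C| * (ε : ℝ) ^ b :=
    mul_le_mul (le_abs_self C) (rpow_anti ε hm3) (Real.rpow_nonneg ε.2.1.le _) (abs_nonneg C)
  change ‖R‖ ≤ _
  linarith [norm_nonneg R]

/-! ### The equivalence -/

theorem isHolomorphic_iff_isSHolomorphic (f : GenFun Ω) : f.IsHolomorphic ↔ f.IsSHolomorphic := by
  constructor
  · intro h
    obtain ⟨u, rfl⟩ := f.exists_rep
    exact isSHolomorphic_of_dbarNull fun j => dbarNet_eq j u ▸ h u rfl j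
  · rintro h u rfl j
    exact dbarNet_eq j u ▸ dbarNull_of_isSHolomorphic h j

end Colombeau

end

theorem theorem9 (p : ℕ) (Ω : TopologicalSpace.Opens (Fin p → ℂ)) (f : Colombeau.GenFun Ω) :
    f.IsHolomorphic ↔ f.IsSHolomorphic :=
  Colombeau.isHolomorphic_iff_isSHolomorphic f
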